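/- Let $q$ be a prime power, $n\ge 1$, and write $[i]=q^i$. Let $\mathcal L_{n,q}$ be the $n$-dimensional $\mathbb F_{q^n}$-vector space of linearized polynomials $\sum_{i=0}^{n-1}a_ix^{[i]}$, $a_i\in\mathbb F_{q^n}$, identified with the $\mathbb F_q$-linear maps $\mathbb F_{q^n}\to\mathbb F_{q^n}$ they induce (exponents $[i]$ are read modulo $n$). An $\mathbb F_{q^n}$-linear code is an $\mathbb F_{q^n}$-subspace of $\mathcal L_{n,q}$; $\dim$ means dimension over $\mathbb F_{q^n}$. It is MRD if $|\mathcal C|=q^{n(n-d+1)}$, where $d$ is its minimum rank distance. Codes $\mathcal C,\mathcal C'$ are equivalent if $\mathcal C'=\{h\circ f^\sigma\circ g: f\in\mathcal C\}$ for some invertible $h,g\in\mathcal L_{n,q}$ and a field automorphism $\sigma$ acting on the coefficients. The Delsarte dual is $\mathcal C^\perp=\{f:\mathrm{Tr}_{q^n/q}(\sum_i f_ig_i)=0\ \forall g\in\mathcal C\}$. A generalized Gabidulin code is a code equivalent to $\mathcal G_{k,s}=\langle x,x^{[s]},\dots,x^{[s(k-1)]}\rangle$ for some $1\le k\le n$ and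 $\gcd(s,n)=1$. Put $\mathcal C^{[j]}=\{f^{[j]}:f\in\mathcal C\}$, where $f^{[j]}=x^{[j]}\circ f$, and $$h(\mathcal C)=\max\{\dim(\mathcal C\cap\mathcal C^{[j]}):1\le j\le n-1,\ \gcd(j,n)=1\},$$ $$\mathrm{ind}(\mathcal C)=\max\{\dim\mathcal G:\mathcal G\subseteq\mathcal C\text{ an }\mathbb F_{q^n}\text{-subspace that is a generalized Gabidulin code}\}.$$ Then the dimension, the Gabidulin index and $h$ take the following values. All codes are $\mathbb F_{q^n}$-linear and spans are over $\mathbb F_{q^n}$. 1. If $1\le k<n$ and $\gcd(s,n)=1$, every code $\mathcal C$ equivalent to $\mathcal G_{k,s}$ has $(\dim,\mathrm{ind},h)=(k,k,k-1)$. 2. If $1<k<n-1$, $\gcd(s,n)=1$, $\eta\in\mathbb F_{q^n}^*$ and $\mathrm N_{q^n/q}(\eta)\ne(-1)^{nk}$, every code equivalent to $\mathcal H_{k,s}(\eta)=\langle x+\eta x^{[sk]},x^{[s]},\dots,x^{[s(k-1)]}\rangle$ has $(\dim,\mathrm{ind},h)=(k,k-1,k-2)$. 3. Let $n=6$, $q>4$,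 and let $\delta\in\mathbb F_{q^6}$ be such that $\mathcal C_1=\langle x,\delta x^{[1]}+x^{[4]}\rangle$ is MRD. Then $\mathcal C_1$ has $(2,1,0)$, while $\mathcal C_1^\perp$ and $\mathcal D_1=\langle x^{[1]},x^{[2]},x^{[4]},x-\delta^{[5]}x^{[3]}\rangle$ have $(4,2,2)$. 4. Let $n=6$, $q$ odd, $q\equiv0,\pm1\pmod 5$, $\delta\in\mathbb F_q$, $\delta^2+\delta=1$. Then $\mathcal C_2=\langle x,x^{[1]}+x^{[3]}+\delta x^{[5]}\rangle$ has $(2,1,0)$, while $\mathcal C_2^\perp$ and $\mathcal D_2=\langle x^{[1]},x^{[3]},x-x^{[2]},x^{[4]}-\delta x\rangle$ have $(4,2,2)$. 5. Let $n=7$, $q$ odd, $\gcd(s,7)=1$. Then $\mathcal C_3=\langle x,x^{[s]},x^{[3s]}\rangle$ has $(3,2,1)$, while $\mathcal C_3^\perp$ and $\mathcal D_3=\langle x,x^{[2s]},x^{[3s]},x^{[4s]}\rangle$ have $(4,3,2)$. 6. Let $n=8$, $q$ odd, $\delta\in\mathbb F_{q^8}$, $\delta^2=-1$. Then $\mathcal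 C_4=\langle x,\delta x^{[1]}+x^{[5]}\rangle$ has $(2,1,0)$, while $\mathcal C_4^\perp$ and $\mathcal D_4=\langle x^{[1]},x^{[2]},x^{[3]},x^{[5]},x^{[6]},x-\delta x^{[4]}\rangle$ have $(6,3,4)$. 7. Let $n=8$, $q\equiv1\pmod 3$, $\gcd(s,8)=1$. Then $\mathcal C_5=\langle x,x^{[s]},x^{[3s]}\rangle$ has $(3,2,1)$, while $\mathcal C_5^\perp$ and $\mathcal D_5=\langle x,x^{[2s]},x^{[3s]},x^{[4s]},x^{[5s]}\rangle$ have $(5,4,3)$. -/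

import Mathlib

/-! Rank-metric codes in the algebra of linearized polynomials.

Throughout `F` is the field with `q = Fintype.card F` elements and `K` is its extension of degree
`n = Module.finrank F K`. The linearized polynomials `∑ aᵢ x^(q^i)`, `i < n`, over `K` are
identified with the `F`-linear maps `K → K` that they represent; `K` acts by
`(c • f)(x) = c * f x`, and an `𝔽_{q^n}`-linear code is a `K`-subspace of `K →ₗ[F] K`. -/

noncomputable section

namespace RankMetric

/-- The monomial `x^[i] = x^(q^i)`. -/
def mono (F K : Type*) [Field F] [Fintype F] [Field K] [Algebra F K] (i : ℕ) : K →ₗ[F] K :=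
  (FiniteField.frobeniusAlgHom F K ^ i).toLinearMap

theorem mono_apply (F K : Type*) [Field F] [Fintype F] [Field K] [Algebra F K] (i : ℕ) (x : K) :
    mono F K i x = x ^ (Fintype.card F ^ i) := by
  simp [mono, AlgHom.coe_pow, FiniteField.coe_frobeniusAlgHom, pow_iterate]

/-- Every `F`-linear map `K → K` is uniquely a linearized polynomial: the monomials
`x^[0], …, x^[n-1]` form a `K`-basis of `K →ₗ[F] K`. -/
def monoBasis (F K : Type*) [Field F] [Fintype F] [Field K] [Finite K] [Algebra F K] :
    Module.Basis (Fin (Module.finrank F K)) K (K →ₗ[F] K) :=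
  haveI : Nonempty (Fin (Module.finrank F K)) := ⟨⟨0, Module.finrank_pos⟩⟩
  basisOfLinearIndependentOfCardEqFinrank
    (b := fun i : Fin (Module.finrank F K) => mono F K i)
    ((linearIndependent_toLinearMap F K K).comp _
      (FiniteField.bijective_frobeniusAlgHom_pow F K).1)
    (by rw [Fintype.card_fin, Module.finrank_linearMap_self])

theorem monoBasis_apply (F K : Type*) [Field F] [Fintype F] [Field K] [Finite K] [Algebra F K]
    (i : Fin (Module.finrank F K)) : monoBasis F K i = mono F K i :=
  haveI : Nonempty (Fin (Module.finrank F K)) := ⟨⟨0, Module.finrank_pos⟩⟩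
  congrFun (coe_basisOfLinearIndependentOfCardEqFinrank _ _) i

/-- The coefficient `aᵢ` of the linearized polynomial `f = ∑ aᵢ x^[i]`. -/
def coeff {F K : Type*} [Field F] [Fintype F] [Field K] [Finite K] [Algebra F K]
    (f : K →ₗ[F] K) (i : Fin (Module.finrank F K)) : K :=
  (monoBasis F K).repr f i

/-- `f^σ`: the field automorphism `σ` applied to the coefficients of `f`. -/
def twist {F K : Type*} [Field F] [Fintype F] [Field K] [Finite K] [Algebra F K]
    (σ : K ≃+* K) (f : K →ₗ[F] K) : K →ₗ[F] K :=
  ∑ i : Fin (Module.finrank F K), σ (coeff f i) • mono F K i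

/-- Equivalence of codes: `{h ∘ f^σ ∘ g : f ∈ C} = C'` for some invertible linearized polynomials
`h`, `g` and some field automorphism `σ`. -/
def Equivalent {F K : Type*} [Field F] [Fintype F] [Field K] [Finite K] [Algebra F K]
    (C C' : Submodule K (K →ₗ[F] K)) : Prop :=
  ∃ (h g : K ≃ₗ[F] K) (σ : K ≃+* K),
    (fun f : K →ₗ[F] K => (h : K →ₗ[F] K) ∘ₗ twist σ f ∘ₗ (g : K →ₗ[F] K)) ''
      (C : Set (K →ₗ[F] K)) = (C' : Set (K →ₗ[F] K))

/-- The minimum rank distance of a code. -/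
def minDist {F K : Type*} [Field F] [Field K] [Algebra F K] (C : Set (K →ₗ[F] K)) : ℕ :=
  sInf {d | ∃ f ∈ C, ∃ g ∈ C, f ≠ g ∧ Module.finrank F (LinearMap.range (f - g)) = d}

/-- Maximum rank distance codes: the Singleton-like bound `|C| ≤ q^(n(n-d+1))` is attained. -/
def IsMRD {F K : Type*} [Field F] [Fintype F] [Field K] [Algebra F K]
    (C : Submodule K (K →ₗ[F] K)) : Prop :=
  Nat.card C = Fintype.card F ^ (Module.finrank F K *
    (Module.finrank F K + 1 - minDist (C : Set (K →ₗ[F] K))))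

/-- The conjugate code `C^[j] = {f^[j] : f ∈ C}`, where `f^[j] = x^[j] ∘ f`. -/
def conj {F K : Type*} [Field F] [Fintype F] [Field K] [Finite K] [Algebra F K]
    (C : Submodule K (K →ₗ[F] K)) (j : ℕ) : Submodule K (K →ₗ[F] K) where
  carrier := (fun f : K →ₗ[F] K => mono F K j ∘ₗ f) '' (C : Set (K →ₗ[F] K))
  zero_mem' := ⟨0, C.zero_mem, LinearMap.comp_zero _⟩
  add_mem' := by
    rintro _ _ ⟨f, hf, rfl⟩ ⟨g, hg, rfl⟩
    exact ⟨f + g, C.add_mem hf hg, LinearMap.comp_add _ _ _⟩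
  smul_mem' := by
    rintro c _ ⟨f, hf, rfl⟩
    obtain ⟨b, hb⟩ : ∃ b, (FiniteField.frobeniusAlgHom F K ^ j) b = c :=
      Finite.surjective_of_injective (FiniteField.frobeniusAlgHom F K ^ j).toRingHom.injective c
    refine ⟨b • f, C.smul_mem b hf, LinearMap.ext fun x => ?_⟩
    change (FiniteField.frobeniusAlgHom F K ^ j) (b * f x) =
      c * (FiniteField.frobeniusAlgHom F K ^ j) (f x)
    rw [map_mul, hb]

/-- `h(C)`, the maximum of `dim (C ∩ C^[j])` over `1 ≤ j ≤ n - 1` with `gcd(j, n) = 1`. -/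
def hIndex {F K : Type*} [Field F] [Fintype F] [Field K] [Finite K] [Algebra F K]
    (C : Submodule K (K →ₗ[F] K)) : ℕ :=
  ((Finset.Ico 1 (Module.finrank F K)).filter fun j => j.Coprime (Module.finrank F K)).sup
    fun j => Module.finrank K (C ⊓ conj C j : Submodule K (K →ₗ[F] K))

/-- `𝒢_{k,s} = ⟨x, x^[s], …, x^[s(k-1)]⟩`. -/
def gabidulin (F K : Type*) [Field F] [Fintype F] [Field K] [Algebra F K] (k s : ℕ) :
    Submodule K (K →ₗ[F] K) :=
  Submodule.span K {f | ∃ i, i < k ∧ f = mono F K (s * i)}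

/-- Generalized Gabidulin codes: the codes equivalent to some `𝒢_{k,s}` with `gcd(s, n) = 1`. -/
def IsGenGabidulin {F K : Type*} [Field F] [Fintype F] [Field K] [Finite K] [Algebra F K]
    (C : Submodule K (K →ₗ[F] K)) : Prop :=
  ∃ k s : ℕ, 1 ≤ k ∧ k ≤ Module.finrank F K ∧ s.Coprime (Module.finrank F K) ∧
    Equivalent (gabidulin F K k s) C

/-- The Gabidulin index `ind(C)`: the maximum dimension of a subcode of `C` that is a generalized
Gabidulin code. -/
def gabidulinIndex {F K : Type*} [Field F] [Fintype F] [Field K] [Finite K] [Algebra F K]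
    (C : Submodule K (K →ₗ[F] K)) : ℕ :=
  sSup {d | ∃ G : Submodule K (K →ₗ[F] K), G ≤ C ∧ IsGenGabidulin G ∧ Module.finrank K G = d}

/-- The Delsarte dual with respect to `b(f, g) = Tr (∑ fᵢ gᵢ)`. -/
def dual {F K : Type*} [Field F] [Fintype F] [Field K] [Finite K] [Algebra F K]
    (C : Submodule K (K →ₗ[F] K)) : Submodule K (K →ₗ[F] K) where
  carrier := {f | ∀ g ∈ C, Algebra.trace F K (∑ i, coeff f i * coeff g i) = 0}
  zero_mem' := by
    intro g _
    simp [coeff]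
  add_mem' := by
    intro f f' hf hf' g hg
    have h1 := hf g hg
    have h2 := hf' g hg
    simp only [coeff, map_add, Finsupp.add_apply, add_mul, Finset.sum_add_distrib] at h1 h2 ⊢
    rw [h1, h2, add_zero]
  smul_mem' := by
    intro c f hf g hg
    have h1 := hf (c • g) (C.smul_mem c hg)
    simpa [coeff, mul_left_comm, mul_assoc] using h1

/-- `ℋ_{k,s}(η) = ⟨x + η x^[sk], x^[s], …, x^[s(k-1)]⟩`. -/
def twistedGabidulin (F : Type*) {K : Type*} [Field F] [Fintype F] [Field K] [Algebra F K]
    (k s : ℕ) (η : K) : Submodule K (K →ₗ[F] K) :=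
  Submodule.span K ({mono F K 0 + η • mono F K (s * k)} ∪
    {f | ∃ i, 1 ≤ i ∧ i < k ∧ f = mono F K (s * i)})

/-- `𝒞₁ = ⟨x, δ x^[1] + x^[4]⟩`, used with `n = 6`. -/
def C₁ (F : Type*) {K : Type*} [Field F] [Fintype F] [Field K] [Algebra F K] (δ : K) :
    Submodule K (K →ₗ[F] K) :=
  Submodule.span K {mono F K 0, δ • mono F K 1 + mono F K 4}

/-- `𝒞₂ = ⟨x, x^[1] + x^[3] + δ x^[5]⟩`, used with `n = 6`. -/
def C₂ (F : Type*) {K : Type*} [Field F] [Fintype F] [Field K] [Algebra F K] (δ : K) :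
    Submodule K (K →ₗ[F] K) :=
  Submodule.span K {mono F K 0, mono F K 1 + mono F K 3 + δ • mono F K 5}

/-- `𝒞₃ = ⟨x, x^[s], x^[3s]⟩` (for `n = 7`) and `𝒞₅`, given by the same formula for `n = 8`. -/
def C₃₅ (F K : Type*) [Field F] [Fintype F] [Field K] [Algebra F K] (s : ℕ) :
    Submodule K (K →ₗ[F] K) :=
  Submodule.span K {mono F K 0, mono F K s, mono F K (3 * s)}

/-- `𝒞₄ = ⟨x, δ x^[1] + x^[5]⟩`, used with `n = 8`. -/
def C₄ (F : Type*) {K : Type*} [Field F] [Fintype F] [Field K] [Algebra F K] (δ : K) :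
    Submodule K (K →ₗ[F] K) :=
  Submodule.span K {mono F K 0, δ • mono F K 1 + mono F K 5}

/-- `𝒟₁ = ⟨x^[1], x^[2], x^[4], x - δ^[5] x^[3]⟩`, used with `n = 6`. -/
def D₁ (F : Type*) {K : Type*} [Field F] [Fintype F] [Field K] [Algebra F K] (δ : K) :
    Submodule K (K →ₗ[F] K) :=
  Submodule.span K {mono F K 1, mono F K 2, mono F K 4,
    mono F K 0 - (δ ^ (Fintype.card F ^ 5)) • mono F K 3}

/-- `𝒟₂ = ⟨x^[1], x^[3], x - x^[2], x^[4] - δ x⟩`, used with `n = 6`. -/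
def D₂ (F : Type*) {K : Type*} [Field F] [Fintype F] [Field K] [Algebra F K] (δ : K) :
    Submodule K (K →ₗ[F] K) :=
  Submodule.span K {mono F K 1, mono F K 3, mono F K 0 - mono F K 2,
    mono F K 4 - δ • mono F K 0}

/-- `𝒟₃ = ⟨x, x^[2s], x^[3s], x^[4s]⟩`, used with `n = 7`. -/
def D₃ (F K : Type*) [Field F] [Fintype F] [Field K] [Algebra F K] (s : ℕ) :
    Submodule K (K →ₗ[F] K) :=
  Submodule.span K {mono F K 0, mono F K (2 * s), mono F K (3 * s), mono F K (4 * s)}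

/-- `𝒟₄ = ⟨x^[1], x^[2], x^[3], x^[5], x^[6], x - δ x^[4]⟩`, used with `n = 8`. -/
def D₄ (F : Type*) {K : Type*} [Field F] [Fintype F] [Field K] [Algebra F K] (δ : K) :
    Submodule K (K →ₗ[F] K) :=
  Submodule.span K {mono F K 1, mono F K 2, mono F K 3, mono F K 5, mono F K 6,
    mono F K 0 - δ • mono F K 4}

/-- `𝒟₅ = ⟨x, x^[2s], x^[3s], x^[4s], x^[5s]⟩`, used with `n = 8`. -/
def D₅ (F K : Type*) [Field F] [Fintype F] [Field K] [Algebra F K] (s : ℕ) :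
    Submodule K (K →ₗ[F] K) :=
  Submodule.span K {mono F K 0, mono F K (2 * s), mono F K (3 * s), mono F K (4 * s),
    mono F K (5 * s)}

/-- One row of the table: `C` has dimension `k`, Gabidulin index `ind(C) = i` and `h(C) = h`. -/
def HasIndexes {F K : Type*} [Field F] [Fintype F] [Field K] [Finite K] [Algebra F K]
    (C : Submodule K (K →ₗ[F] K)) (k i h : ℕ) : Prop :=
  Module.finrank K C = k ∧ gabidulinIndex C = i ∧ hIndex C = h

end RankMetric

end

/-! All indices are read off from coefficients. Composing with `x^[j]` on the left shifts the
exponents of a linearized polynomial by `j` modulo `n` and applies a field automorphism to its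
coefficients, so membership in a code or in a conjugate code becomes a set of conditions on
coefficients.

Equivalent codes are reduced to the standard ones through the left idealizer. For the Gabidulin
codes with `k < n` and the twisted ones it consists of the multiplications by elements of `K`. If
the image of such a code under `f ↦ h ∘ f^σ ∘ g` is again `K`-linear, then `h` must carry
multiplications to multiplications, hence `h = a x^[i]` (`Equivalent.exists_conj_map`). What remains
is a coefficient twist, a conjugation and a composition on the right; the last two preserve all
three indices, and a twist maps the standard family to itself.

A Gabidulin subcode of dimension `d < n` contains a chain `g, g^[s], …, g^[(d-1)s]` with `g`
invertible, and `g^[s], …, g^[(d-1)s]` also lie in `C^[s]`. This gives `ind ≤ h + 1`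
(`gabidulinIndex_le_hIndex_add_one`), which an explicit chain shows to be sharp for the Gabidulin,
twisted and monomial codes and for the two-dimensional sporadic ones. For the other sporadic codes
`ind` is smaller than `h + 1`: the lower bound for `h` is the dimension formula `2 dim C - n`, and a
chain one step too long is shown to have all coefficients of `g` equal to zero. The MRD hypothesis
on the first code enters by forcing `δ ≠ 0`. -/

namespace RankMetric

open Module

/-! ### Coefficients modulo `n`, conjugate codes and `h` -/

section Basic

theorem linearIndependent_of_dual {k V ι : Type*} [Field k] [AddCommGroup V] [Module k V]
    [Fintype ι] [DecidableEq ι] (v : ι → V) (φ : ι → V →ₗ[k] k)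
    (h : ∀ i j, φ j (v i) = if i = j then 1 else 0) : LinearIndependent k v := by
  refine Fintype.linearIndependent_iff.2 fun g hg j => ?_
  have := congrArg (φ j) hg
  simpa [h] using this

variable {F K : Type*} [Field F] [Fintype F] [Field K] [Algebra F K]

/-- The automorphism `x ↦ x^(q^j)` of `K` over `F`. -/
noncomputable def frob (F K : Type*) [Field F] [Fintype F] [Field K] [Algebra F K] (j : ℕ) :
    K →ₐ[F] K :=
  FiniteField.frobeniusAlgHom F K ^ j

theorem mono_eq_frob (j : ℕ) (x : K) : mono F K j x = frob F K j x := rfl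

theorem frob_add_apply (i j : ℕ) (x : K) : frob F K (i + j) x = frob F K i (frob F K j x) := by
  simp [frob, pow_add]

theorem mono_zero : mono F K 0 = LinearMap.id := rfl

theorem mono_comp_mono (i j : ℕ) : mono F K i ∘ₗ mono F K j = mono F K (i + j) := by
  ext x
  simp [mono_eq_frob, frob_add_apply]

theorem mono_comp_smul (j : ℕ) (c : K) (f : K →ₗ[F] K) :
    mono F K j ∘ₗ (c • f) = frob F K j c • (mono F K j ∘ₗ f) := by
  ext x
  simp [mono_eq_frob]

omit [Fintype F] in
theorem comp_finsetSum {ι : Type*} (S : Finset ι) (g : K →ₗ[F] K) (f : ι → K →ₗ[F] K) :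
    g ∘ₗ ∑ i ∈ S, f i = ∑ i ∈ S, g ∘ₗ f i := by
  ext x
  simp

omit [Fintype F] in
theorem finsetSum_comp {ι : Type*} (S : Finset ι) (g : K →ₗ[F] K) (f : ι → K →ₗ[F] K) :
    (∑ i ∈ S, f i) ∘ₗ g = ∑ i ∈ S, f i ∘ₗ g := by
  ext x
  simp

variable [Finite K]

theorem frob_congr {i j : ℕ} (h : i ≡ j [MOD finrank F K]) : frob F K i = frob F K j := by
  rw [frob, frob, ← pow_mod_orderOf _ i, ← pow_mod_orderOf _ j,
    FiniteField.orderOf_frobeniusAlgHom, h]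

theorem mono_congr {i j : ℕ} (h : i ≡ j [MOD finrank F K]) : mono F K i = mono F K j := by
  change (frob F K i).toLinearMap = (frob F K j).toLinearMap
  rw [frob_congr h]

theorem frob_surjective (j : ℕ) : Function.Surjective (frob F K j) :=
  Finite.surjective_of_injective (frob F K j).toRingHom.injective

/-- The coefficient of `x^[i]` of a linearized polynomial, with `i` read modulo `n`. -/
noncomputable def coeffAt (i : ℕ) : (K →ₗ[F] K) →ₗ[K] K :=
  (monoBasis F K).coord ⟨i % finrank F K, Nat.mod_lt _ finrank_pos⟩

theorem coeffAt_val (f : K →ₗ[F] K) (i : Fin (finrank F K)) :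
    coeffAt (i : ℕ) f = coeff f i := by
  have : (⟨(i : ℕ) % finrank F K, Nat.mod_lt _ finrank_pos⟩ : Fin (finrank F K)) = i :=
    Fin.ext (Nat.mod_eq_of_lt i.2)
  simp [coeffAt, coeff, this]

theorem coeffAt_congr {i j : ℕ} (h : i ≡ j [MOD finrank F K]) :
    (coeffAt i : (K →ₗ[F] K) →ₗ[K] K) = coeffAt j := by
  have : i % finrank F K = j % finrank F K := h
  simp [coeffAt, this]

theorem coeffAt_mod (i : ℕ) :
    (coeffAt (i % finrank F K) : (K →ₗ[F] K) →ₗ[K] K) = coeffAt i :=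
  coeffAt_congr (Nat.mod_modEq _ _)

theorem coeffAt_mono (i j : ℕ) :
    coeffAt i (mono F K j) = if j ≡ i [MOD finrank F K] then 1 else 0 := by
  have h1 : mono F K j = monoBasis F K ⟨j % finrank F K, Nat.mod_lt _ finrank_pos⟩ := by
    rw [monoBasis_apply]
    exact mono_congr (Nat.mod_modEq _ _).symm
  rw [h1, coeffAt, Basis.coord_apply, Basis.repr_self, Finsupp.single_apply]
  simp only [Fin.mk.injEq]
  rfl

theorem coeffAt_mono_self (i : ℕ) : coeffAt i (mono F K i) = 1 := by
  classical
  rw [coeffAt_mono, if_pos (Nat.ModEq.refl i)]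

theorem sum_coeffAt (f : K →ₗ[F] K) :
    ∑ i ∈ Finset.range (finrank F K), coeffAt i f • mono F K i = f := by
  rw [Finset.sum_range (fun i => coeffAt i f • mono F K i)]
  conv_rhs => rw [← (monoBasis F K).sum_repr f]
  refine Finset.sum_congr rfl fun i _ => ?_
  rw [coeffAt_val, monoBasis_apply]
  rfl

theorem coeffAt_mono_comp (i j : ℕ) (f : K →ₗ[F] K) :
    coeffAt (i + j) (mono F K j ∘ₗ f) = frob F K j (coeffAt i f) := by
  classical
  conv_lhs => rw [← sum_coeffAt f]
  conv_rhs => rw [← sum_coeffAt f]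
  simp only [map_sum, comp_finsetSum, mono_comp_smul, mono_comp_mono, map_smul, coeffAt_mono,
    smul_eq_mul, map_mul]
  refine Finset.sum_congr rfl fun a _ => ?_
  have : j + a ≡ i + j [MOD finrank F K] ↔ a ≡ i [MOD finrank F K] := by
    rw [add_comm i j]
    exact ⟨Nat.ModEq.add_left_cancel' j, Nat.ModEq.add_left j⟩
  by_cases h : a ≡ i [MOD finrank F K] <;> simp [this, h]

/-- A scalar on the right is not central: it meets the coefficient of `x^[i]` as `c^[i]`. Letting
`c` vary therefore separates exponents, which pins down `h` in an equivalence and settles the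
idealizer of the twisted codes with `k = 2`. -/
theorem coeffAt_comp_smul_mono (i j : ℕ) (c : K) (f : K →ₗ[F] K) :
    coeffAt (i + j) (f ∘ₗ (c • mono F K j)) = coeffAt i f * frob F K i c := by
  classical
  conv_lhs => rw [← sum_coeffAt f]
  conv_rhs => rw [← sum_coeffAt f]
  simp only [map_sum, finsetSum_comp, LinearMap.smul_comp, mono_comp_smul, mono_comp_mono,
    map_smul, coeffAt_mono, smul_eq_mul, Finset.sum_mul]
  refine Finset.sum_congr rfl fun a _ => ?_
  have : a + j ≡ i + j [MOD finrank F K] ↔ a ≡ i [MOD finrank F K] :=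
    ⟨Nat.ModEq.add_right_cancel' j, Nat.ModEq.add_right j⟩
  by_cases h : a ≡ i [MOD finrank F K]
  · simp [this, h, frob_congr h]
  · simp [this, h]

theorem coeffAt_comp_mono (i j : ℕ) (f : K →ₗ[F] K) :
    coeffAt (i + j) (f ∘ₗ mono F K j) = coeffAt i f := by
  simpa using coeffAt_comp_smul_mono i j 1 f

theorem coeffAt_twist (σ : K ≃+* K) (f : K →ₗ[F] K) (i : ℕ) :
    coeffAt i (twist σ f) = σ (coeffAt i f) := by
  have h : twist σ f = ∑ a ∈ Finset.range (finrank F K), σ (coeffAt a f) • mono F K a := by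
    rw [Finset.sum_range (fun a => σ (coeffAt a f) • mono F K a)]
    simp only [coeffAt_val]
    rfl
  classical
  rw [h]
  conv_rhs => rw [← sum_coeffAt f]
  simp only [map_sum, map_smul, coeffAt_mono, smul_eq_mul, map_mul]
  refine Finset.sum_congr rfl fun a _ => ?_
  split_ifs <;> simp

/-- Since `s` is a unit modulo `n`, positions can be labelled `s * t` with `t < n`, so that `x^[s]`
acts as a shift by one. -/
theorem exists_mul_modEq {n s : ℕ} (hn : 0 < n) (hs : s.Coprime n) (i : ℕ) :
    ∃ t < n, s * t ≡ i [MOD n] := by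
  rcases Nat.lt_or_ge 1 n with h1 | h1
  · obtain ⟨m, -, hm⟩ := Nat.exists_mul_mod_eq_one_of_coprime hs h1
    refine ⟨m * i % n, Nat.mod_lt _ hn, ?_⟩
    calc s * (m * i % n) ≡ s * (m * i) [MOD n] := (Nat.mod_modEq _ _).mul_left s
      _ = s * m * i := (mul_assoc _ _ _).symm
      _ ≡ 1 * i [MOD n] := Nat.ModEq.mul_right i (by rw [Nat.ModEq, hm, Nat.mod_eq_of_lt h1])
      _ = i := one_mul i
  · obtain rfl : n = 1 := by omega
    exact ⟨0, hn, Nat.modEq_one⟩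

theorem mul_modEq_iff {n s t u : ℕ} (hs : s.Coprime n) (ht : t < n) (hu : u < n) :
    s * t ≡ s * u [MOD n] ↔ t = u := by
  refine ⟨fun h => ?_, fun h => h ▸ rfl⟩
  exact Nat.ModEq.eq_of_lt_of_lt (Nat.ModEq.cancel_left_of_coprime hs.symm h) ht hu

theorem coeffAt_mono_mul {s t u : ℕ} (hs : s.Coprime (finrank F K)) (ht : t < finrank F K)
    (hu : u < finrank F K) : coeffAt (s * u) (mono F K (s * t)) = if t = u then (1 : K) else 0 := by
  rw [coeffAt_mono]
  simp only [mul_modEq_iff hs ht hu]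

theorem eq_zero_of_coeffAt {s : ℕ} (hs : s.Coprime (finrank F K)) {f : K →ₗ[F] K}
    (h : ∀ t < finrank F K, coeffAt (s * t) f = 0) : f = 0 := by
  rw [← sum_coeffAt f]
  refine Finset.sum_eq_zero fun i _ => ?_
  obtain ⟨t, ht, hti⟩ := exists_mul_modEq (finrank_pos (R := F) (M := K)) hs i
  rw [← coeffAt_congr hti, h t ht, zero_smul]

theorem coeffAt_sum_mul {s : ℕ} (hs : s.Coprime (finrank F K)) (S : Finset ℕ)
    (hS : S ⊆ Finset.range (finrank F K)) (c : ℕ → K) {u : ℕ} (hu : u < finrank F K) :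
    coeffAt (s * u) (∑ t ∈ S, c t • mono F K (s * t)) = if u ∈ S then c u else 0 := by
  classical
  simp only [map_sum, map_smul, coeffAt_mono, smul_eq_mul, mul_ite, mul_one, mul_zero]
  rw [← Finset.sum_ite_eq S u c]
  refine Finset.sum_congr rfl fun t ht => ?_
  simp [mul_modEq_iff hs (Finset.mem_range.1 (hS ht)) hu, eq_comm]

theorem sum_coeffAt_mul {s : ℕ} (hs : s.Coprime (finrank F K)) (f : K →ₗ[F] K) :
    ∑ t ∈ Finset.range (finrank F K), coeffAt (s * t) f • mono F K (s * t) = f := by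
  rw [← sub_eq_zero]
  refine eq_zero_of_coeffAt hs fun t ht => ?_
  rw [map_sub, coeffAt_sum_mul hs _ subset_rfl (fun t => coeffAt (s * t) f) ht,
    if_pos (Finset.mem_range.2 ht), sub_self]

/-- The number of coordinates that determine the elements of a code bounds its dimension. -/
theorem finrank_le_card (W : Submodule K (K →ₗ[F] K)) (T : Finset ℕ) (s : ℕ)
    (h : ∀ f ∈ W, (∀ t ∈ T, coeffAt (s * t) f = 0) → f = 0) : finrank K W ≤ T.card := by
  let Φ : W →ₗ[K] (T → K) := LinearMap.pi fun t => coeffAt (s * (t : ℕ)) ∘ₗ W.subtype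
  have hΦ : Function.Injective Φ := by
    rw [injective_iff_map_eq_zero]
    intro f hf
    exact Subtype.ext (h f f.2 fun t ht => congrFun hf ⟨t, ht⟩)
  simpa using LinearMap.finrank_le_finrank_of_injective hΦ

theorem card_le_finrank_of_dual {ι : Type*} [Fintype ι] [DecidableEq ι]
    (W : Submodule K (K →ₗ[F] K)) (v : ι → K →ₗ[F] K) (t : ι → ℕ) (hv : ∀ i, v i ∈ W)
    (h : ∀ i j, coeffAt (t j) (v i) = if i = j then 1 else 0) :
    Fintype.card ι ≤ finrank K W := by
  have h2 : Fintype.card ι ≤ finrank K (Submodule.span K (Set.range v)) :=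
    (finrank_span_eq_card (linearIndependent_of_dual v (fun j => coeffAt (t j)) h)).ge
  exact h2.trans (Submodule.finrank_mono (Submodule.span_le.2 (Set.range_subset_iff.2 hv)))

/-- Membership in a conjugate code. -/
theorem mem_conj_iff {C : Submodule K (K →ₗ[F] K)} {j j' : ℕ}
    (h : j + j' ≡ 0 [MOD finrank F K]) {f : K →ₗ[F] K} :
    f ∈ conj C j ↔ mono F K j' ∘ₗ f ∈ C := by
  constructor
  · rintro ⟨g, hg, rfl⟩
    change mono F K j' ∘ₗ mono F K j ∘ₗ g ∈ C
    rw [← LinearMap.comp_assoc, mono_comp_mono, mono_congr (j := 0) (by rwa [add_comm]), mono_zero]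
    exact hg
  · intro hf
    refine ⟨_, hf, ?_⟩
    change mono F K j ∘ₗ mono F K j' ∘ₗ f = f
    rw [← LinearMap.comp_assoc, mono_comp_mono, mono_congr h, mono_zero]
    rfl

theorem mono_comp_mem_conj {C : Submodule K (K →ₗ[F] K)} {f : K →ₗ[F] K} (hf : f ∈ C) (j : ℕ) :
    mono F K j ∘ₗ f ∈ conj C j :=
  ⟨f, hf, rfl⟩

theorem conj_congr (C : Submodule K (K →ₗ[F] K)) {i j : ℕ} (h : i ≡ j [MOD finrank F K]) :
    conj C i = conj C j := by
  ext f
  change (∃ g ∈ C, mono F K i ∘ₗ g = f) ↔ (∃ g ∈ C, mono F K j ∘ₗ g = f)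
  rw [mono_congr h]

theorem exists_add_modEq_zero {n : ℕ} (hn : 0 < n) (j : ℕ) : ∃ j', j + j' ≡ 0 [MOD n] :=
  -- A representative of `-j`; the subtraction does not truncate because `n > 0`.
  ⟨n * j - j, by
    rw [Nat.add_sub_of_le (Nat.le_mul_of_pos_left j hn)]
    exact (Nat.modEq_zero_iff_dvd).2 (dvd_mul_right n j)⟩

omit [Finite K] in
theorem mono_comp_injective (j : ℕ) :
    Function.Injective fun f : K →ₗ[F] K => mono F K j ∘ₗ f := by
  intro f g h
  ext x
  exact (frob F K j).toRingHom.injective (LinearMap.congr_fun h x)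

-- Conjugation is only semilinear over `K` and a general equivalence is not even that, so dimensions
-- are compared by counting elements.
omit [Fintype F] in
theorem finrank_eq_of_card_eq {V W : Submodule K (K →ₗ[F] K)} (h : Nat.card V = Nat.card W) :
    finrank K V = finrank K W := by
  rw [natCard_eq_pow_finrank (K := K) (V := V), natCard_eq_pow_finrank (K := K) (V := W)] at h
  exact Nat.pow_right_injective Finite.one_lt_card h

theorem finrank_conj (C : Submodule K (K →ₗ[F] K)) (j : ℕ) : finrank K (conj C j) = finrank K C :=
  finrank_eq_of_card_eq (Nat.card_image_of_injective (mono_comp_injective j) (C : Set (K →ₗ[F] K)))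

theorem conj_conj (C : Submodule K (K →ₗ[F] K)) (i j : ℕ) :
    conj (conj C i) j = conj C (i + j) := by
  ext f
  constructor
  · rintro ⟨_, ⟨g, hg, rfl⟩, rfl⟩
    refine ⟨g, hg, ?_⟩
    change mono F K (i + j) ∘ₗ g = mono F K j ∘ₗ mono F K i ∘ₗ g
    rw [← LinearMap.comp_assoc, mono_comp_mono, add_comm]
  · rintro ⟨g, hg, rfl⟩
    refine ⟨_, ⟨g, hg, rfl⟩, ?_⟩
    change mono F K j ∘ₗ mono F K i ∘ₗ g = mono F K (i + j) ∘ₗ g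
    rw [← LinearMap.comp_assoc, mono_comp_mono, add_comm]

theorem conj_zero (C : Submodule K (K →ₗ[F] K)) : conj C 0 = C := by
  ext f
  rw [mem_conj_iff (j' := 0) rfl]
  exact Iff.rfl

theorem conj_inf (C D : Submodule K (K →ₗ[F] K)) (j : ℕ) :
    conj (C ⊓ D) j = conj C j ⊓ conj D j := by
  obtain ⟨j', hj'⟩ := exists_add_modEq_zero (finrank_pos (R := F) (M := K)) j
  ext f
  simp only [Submodule.mem_inf, mem_conj_iff hj']

/-- Conjugating `C ∩ C^[j]` by `j' = -j` gives `C^[-j] ∩ C`; only half of the shifts then need to be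
examined. -/
theorem finrank_inf_conj_symm (C : Submodule K (K →ₗ[F] K)) {j j' : ℕ}
    (h : j + j' ≡ 0 [MOD finrank F K]) :
    finrank K (C ⊓ conj C j : Submodule K (K →ₗ[F] K)) =
      finrank K (C ⊓ conj C j' : Submodule K (K →ₗ[F] K)) := by
  rw [← finrank_conj (C ⊓ conj C j) j', conj_inf, conj_conj, conj_congr C h, conj_zero, inf_comm]

theorem coprime_congr {n i j : ℕ} (h : i ≡ j [MOD n]) : i.Coprime n ↔ j.Coprime n := by
  rw [Nat.Coprime, Nat.Coprime, h.gcd_eq]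

theorem mod_pos_of_coprime {n j : ℕ} (hn : 1 < n) (hj : j.Coprime n) : 0 < j % n := by
  refine Nat.pos_of_ne_zero fun h0 => ?_
  have h1 := (coprime_congr (Nat.mod_modEq j n)).2 hj
  rw [h0, Nat.coprime_zero_left] at h1
  omega

theorem finrank_inf_conj_le_hIndex (C : Submodule K (K →ₗ[F] K)) {s : ℕ} (hn : 1 < finrank F K)
    (hs : s.Coprime (finrank F K)) :
    finrank K (C ⊓ conj C s : Submodule K (K →ₗ[F] K)) ≤ hIndex C := by
  have hmem : s % finrank F K ∈ (Finset.Ico 1 (finrank F K)).filter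
      fun j => j.Coprime (finrank F K) := by
    rw [Finset.mem_filter, Finset.mem_Ico]
    exact ⟨⟨mod_pos_of_coprime hn hs, Nat.mod_lt _ finrank_pos⟩,
      (coprime_congr (Nat.mod_modEq _ _)).2 hs⟩
  rw [← conj_congr C (Nat.mod_modEq s (finrank F K))]
  exact Finset.le_sup (f := fun j => finrank K (C ⊓ conj C j : Submodule K (K →ₗ[F] K))) hmem

theorem hIndex_le_finrank (C : Submodule K (K →ₗ[F] K)) : hIndex C ≤ finrank K C :=
  Finset.sup_le fun _ _ => Submodule.finrank_mono inf_le_left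

/-- `h(C)` computed with the generator `x ↦ x^[s]` of the Galois group. -/
theorem hIndex_eq {C : Submodule K (K →ₗ[F] K)} {s m : ℕ} (hn : 1 < finrank F K)
    (hs : s.Coprime (finrank F K))
    (hle : ∀ j, 0 < j → j < finrank F K → j.Coprime (finrank F K) →
      finrank K (C ⊓ conj C (s * j) : Submodule K (K →ₗ[F] K)) ≤ m)
    (hge : m ≤ finrank K (C ⊓ conj C s : Submodule K (K →ₗ[F] K))) : hIndex C = m := by
  refine le_antisymm (Finset.sup_le fun i hi => ?_)
    (hge.trans (finrank_inf_conj_le_hIndex C hn hs))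
  obtain ⟨-, hi2⟩ := Finset.mem_filter.1 hi
  obtain ⟨j, hj, hji⟩ := exists_mul_modEq (finrank_pos (R := F) (M := K)) hs i
  rw [← conj_congr C hji]
  have hjc : j.Coprime (finrank F K) := Nat.Coprime.coprime_mul_left ((coprime_congr hji).2 hi2)
  have h0 := mod_pos_of_coprime hn hjc
  rw [Nat.mod_eq_of_lt hj] at h0
  exact hle j h0 hj hjc

end Basic

/-! ### Monomial codes, equivalence, and general bounds for the Gabidulin index -/

section Equivalence

variable {F K : Type*} [Field F] [Fintype F] [Field K] [Finite K] [Algebra F K]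

/-- The code spanned by the monomials `x^[st]`, `t ∈ S`. -/
noncomputable def supportCode (F K : Type*) [Field F] [Fintype F] [Field K] [Algebra F K] (s : ℕ)
    (S : Finset ℕ) : Submodule K (K →ₗ[F] K) :=
  Submodule.span K ((fun t => mono F K (s * t)) '' S)

omit [Finite K] in
theorem mono_mem_supportCode {s t : ℕ} {S : Finset ℕ} (ht : t ∈ S) :
    mono F K (s * t) ∈ supportCode F K s S :=
  Submodule.subset_span ⟨t, ht, rfl⟩

theorem mem_supportCode {s : ℕ} (hs : s.Coprime (finrank F K)) {S : Finset ℕ}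
    (hS : S ⊆ Finset.range (finrank F K)) {f : K →ₗ[F] K} :
    f ∈ supportCode F K s S ↔ ∀ t < finrank F K, t ∉ S → coeffAt (s * t) f = 0 := by
  classical
  constructor
  · intro hf t ht htS
    induction hf using Submodule.span_induction with
    | mem x hx =>
      obtain ⟨u, hu, rfl⟩ := hx
      rw [coeffAt_mono, if_neg]
      rw [mul_modEq_iff hs (Finset.mem_range.1 (hS hu)) ht]
      rintro rfl
      exact htS hu
    | zero => exact map_zero _
    | add x y _ _ hx hy => rw [map_add, hx, hy, add_zero]
    | smul a x _ hx => rw [map_smul, hx, smul_zero]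
  · intro h
    rw [← sum_coeffAt_mul hs f]
    refine Submodule.sum_mem _ fun t ht => ?_
    by_cases htS : t ∈ S
    · exact Submodule.smul_mem _ _ (mono_mem_supportCode htS)
    · rw [h t (Finset.mem_range.1 ht) htS, zero_smul]
      exact Submodule.zero_mem _

theorem finrank_supportCode {s : ℕ} (hs : s.Coprime (finrank F K)) {S : Finset ℕ}
    (hS : S ⊆ Finset.range (finrank F K)) : finrank K (supportCode F K s S) = S.card := by
  classical
  apply le_antisymm
  · refine finrank_le_card _ S s fun f hf h => eq_zero_of_coeffAt hs fun t ht => ?_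
    by_cases htS : t ∈ S
    · exact h t htS
    · exact (mem_supportCode hs hS).1 hf t ht htS
  · have := card_le_finrank_of_dual (supportCode F K s S) (fun t : S => mono F K (s * (t : ℕ)))
      (fun t => s * (t : ℕ)) (fun t => mono_mem_supportCode t.2) fun t u => by
        rw [coeffAt_mono]
        simp only [mul_modEq_iff hs (Finset.mem_range.1 (hS t.2)) (Finset.mem_range.1 (hS u.2)),
          Subtype.ext_iff]
    simpa using this

/-- Conjugation by `s * j` translates the support by `j`, so `h` of a monomial code counts the
overlap of a subset of `ℤ/n` with its translates. The summand `n - j` stands for `-j`. -/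
theorem supportCode_inf_conj {s j : ℕ} (hs : s.Coprime (finrank F K)) (hj : j ≤ finrank F K)
    {S : Finset ℕ} (hS : S ⊆ Finset.range (finrank F K)) :
    supportCode F K s S ⊓ conj (supportCode F K s S) (s * j) =
      supportCode F K s {t ∈ S | (t + (finrank F K - j)) % finrank F K ∈ S} := by
  have h0 : s * j + s * (finrank F K - j) ≡ 0 [MOD finrank F K] := by
    rw [← mul_add, Nat.add_sub_of_le hj]
    exact Nat.modEq_zero_iff_dvd.2 (dvd_mul_left _ _)
  ext f
  rw [Submodule.mem_inf, mem_conj_iff h0, mem_supportCode hs hS, mem_supportCode hs hS,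
    mem_supportCode hs ((Finset.filter_subset _ _).trans hS)]
  have hpos := finrank_pos (R := F) (M := K)
  have key : ∀ t, t < finrank F K →
      (coeffAt (s * ((t + (finrank F K - j)) % finrank F K)) (mono F K (s * (finrank F K - j)) ∘ₗ f)
        = 0 ↔ coeffAt (s * t) f = 0) := fun t ht => by
    rw [coeffAt_congr (j := s * t + s * (finrank F K - j)), coeffAt_mono_comp, map_eq_zero]
    rw [← mul_add]
    exact (Nat.mod_modEq _ _).mul_left s
  constructor
  · rintro ⟨h1, h2⟩ t ht htS
    by_cases h : t ∈ S
    · rw [← key t ht]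
      exact h2 _ (Nat.mod_lt _ hpos) fun h' => htS (Finset.mem_filter.2 ⟨h, h'⟩)
    · exact h1 t ht h
  · refine fun h => ⟨fun t ht htS => h t ht fun h' => htS (Finset.mem_filter.1 h').1,
      fun u hu huS => ?_⟩
    have hu' : ((u + j) % finrank F K + (finrank F K - j)) % finrank F K = u := by
      rw [Nat.mod_add_mod, add_assoc, Nat.add_sub_of_le hj, Nat.add_mod_right, Nat.mod_eq_of_lt hu]
    have := (key ((u + j) % finrank F K) (Nat.mod_lt _ hpos)).2
      (h _ (Nat.mod_lt _ hpos) fun h' => huS (hu' ▸ (Finset.mem_filter.1 h').2))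
    rwa [hu'] at this

omit [Finite K] in
theorem gabidulin_eq_supportCode (k s : ℕ) :
    gabidulin F K k s = supportCode F K s (Finset.range k) := by
  unfold gabidulin supportCode
  congr 1
  ext f
  simp [eq_comm]

/-- Composition with an invertible map on the right. -/
noncomputable def compRight (g : K ≃ₗ[F] K) : (K →ₗ[F] K) ≃ₗ[K] (K →ₗ[F] K) :=
  LinearEquiv.congrLeft K K g.symm

omit [Fintype F] [Finite K] in
theorem compRight_apply (g : K ≃ₗ[F] K) (f : K →ₗ[F] K) :
    compRight g f = f ∘ₗ (g : K →ₗ[F] K) := rfl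

theorem conj_map_compRight (C : Submodule K (K →ₗ[F] K)) (j : ℕ) (g : K ≃ₗ[F] K) :
    conj (C.map (compRight g).toLinearMap) j = (conj C j).map (compRight g).toLinearMap := by
  ext f
  constructor
  · rintro ⟨_, ⟨f, hf, rfl⟩, rfl⟩
    exact ⟨_, ⟨f, hf, rfl⟩, rfl⟩
  · rintro ⟨_, ⟨f, hf, rfl⟩, rfl⟩
    exact ⟨_, ⟨f, hf, rfl⟩, rfl⟩

theorem twist_injective (σ : K ≃+* K) :
    Function.Injective (twist σ : (K →ₗ[F] K) → (K →ₗ[F] K)) := by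
  intro f g h
  rw [← sum_coeffAt f, ← sum_coeffAt g]
  refine Finset.sum_congr rfl fun i _ => ?_
  have := congrArg (coeffAt i) h
  rw [coeffAt_twist, coeffAt_twist] at this
  rw [σ.injective this]

theorem twist_surjective (σ : K ≃+* K) :
    Function.Surjective (twist σ : (K →ₗ[F] K) → (K →ₗ[F] K)) :=
  haveI : Finite (K →ₗ[F] K) := Module.finite_of_finite K
  Finite.surjective_of_injective (twist_injective σ)

theorem twist_refl (f : K →ₗ[F] K) : twist (RingEquiv.refl K) f = f := by
  rw [← sum_coeffAt f, ← sum_coeffAt (twist _ _)]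
  refine Finset.sum_congr rfl fun i _ => ?_
  rw [coeffAt_twist, sum_coeffAt]
  rfl

theorem Equivalent.finrank_eq {C C' : Submodule K (K →ₗ[F] K)} (h : Equivalent C C') :
    finrank K C' = finrank K C := by
  obtain ⟨h, g, σ, hC⟩ := h
  refine finrank_eq_of_card_eq ?_
  have hinj : Function.Injective
      fun f : K →ₗ[F] K => (h : K →ₗ[F] K) ∘ₗ twist σ f ∘ₗ (g : K →ₗ[F] K) := by
    intro f f' hff
    refine twist_injective σ (LinearMap.ext fun x => h.injective ?_)
    simpa using LinearMap.congr_fun hff (g.symm x)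
  refine (Nat.card_congr (Equiv.setCongr hC.symm)).trans ?_
  exact Nat.card_image_of_injective hinj (C : Set (K →ₗ[F] K))

/-- If the twists of `C` have left idealizer `K`, then every code equivalent to `C` arises from a
twist by conjugation and by composition on the right. -/
theorem Equivalent.exists_conj_map {C C' : Submodule K (K →ₗ[F] K)} (h : Equivalent C C')
    (D : (K ≃+* K) → Submodule K (K →ₗ[F] K)) (hD : ∀ σ f, twist σ f ∈ D σ ↔ f ∈ C)
    (hid : ∀ σ (φ : K →ₗ[F] K), (∀ f ∈ D σ, φ ∘ₗ f ∈ D σ) → ∃ c : K, φ = c • LinearMap.id) :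
    ∃ (σ : K ≃+* K) (i : ℕ) (g : K ≃ₗ[F] K),
      C' = (conj (D σ) i).map (compRight g).toLinearMap := by
  obtain ⟨h, g, σ, hC⟩ := h
  have hmem : ∀ f, (h : K →ₗ[F] K) ∘ₗ f ∘ₗ (g : K →ₗ[F] K) ∈ C' ↔ f ∈ D σ := by
    intro f
    obtain ⟨f, rfl⟩ := twist_surjective (F := F) σ f
    rw [hD, ← SetLike.mem_coe, ← hC]
    constructor
    · rintro ⟨f', hf', hff⟩
      have hff' : f = f' := by
        refine twist_injective σ (LinearMap.ext fun x => h.injective ?_)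
        simpa using (LinearMap.congr_fun hff (g.symm x)).symm
      rwa [hff']
    · exact fun hf => ⟨f, hf, rfl⟩
  have h1 : ∀ c : K, ∃ b : K, ∀ x, h (b * x) = c * h x := by
    intro c
    -- As `C'` is closed under multiplication by `c`, the map `h⁻¹ ∘ c ∘ h` is in the left idealizer
    -- of `D σ`, so it is multiplication by some `b`.
    obtain ⟨b, hb⟩ := hid σ ((h.symm : K →ₗ[F] K) ∘ₗ (c • (h : K →ₗ[F] K))) fun f hf => by
      rw [← hmem] at hf ⊢
      convert C'.smul_mem c hf using 1
      ext x
      simp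
    refine ⟨b, fun x => ?_⟩
    have := LinearMap.congr_fun hb x
    simp only [LinearMap.comp_apply, LinearMap.smul_apply, LinearMap.id_apply, smul_eq_mul,
      LinearEquiv.coe_coe] at this
    rw [← this, LinearEquiv.apply_symm_apply]
  choose θ hθ using h1
  have h2 : ∃ i, coeffAt i (h : K →ₗ[F] K) ≠ 0 := by
    by_contra hcon
    push Not at hcon
    have h0 : (h : K →ₗ[F] K) = 0 := by
      rw [← sum_coeffAt (h : K →ₗ[F] K)]
      exact Finset.sum_eq_zero fun i _ => by rw [hcon, zero_smul]
    have := LinearMap.congr_fun h0 1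
    simp at this
  obtain ⟨i, hi⟩ := h2
  -- Comparing coefficients of `x^[i]` in `h(θ(c) x) = c h(x)`, at a position where `h` does not
  -- vanish, shows that `θ` inverts `x^[i]`. Evaluating at `x = 1` then yields `h = h(1) x^[i]`.
  have h3 : ∀ c, frob F K i (θ c) = c := by
    intro c
    have h4 := coeffAt_comp_smul_mono i 0 (θ c) (h : K →ₗ[F] K)
    have h5 : (h : K →ₗ[F] K) ∘ₗ (θ c • mono F K 0) = c • (h : K →ₗ[F] K) := by
      ext x
      simpa [mono_zero] using hθ c x
    rw [h5, map_smul, smul_eq_mul, mul_comm, add_zero] at h4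
    exact (mul_left_cancel₀ hi h4).symm
  have h4 : ∀ y, h y = h 1 * frob F K i y := by
    intro y
    have h5 : θ (frob F K i y) = y := (frob F K i).toRingHom.injective (h3 _)
    have h6 := hθ (frob F K i y) 1
    rw [h5, mul_one] at h6
    rw [h6, mul_comm]
  have ha : h 1 ≠ 0 := by simp
  refine ⟨σ, i, g, SetLike.ext fun f => ?_⟩
  constructor
  · intro hf
    have h5 : (h : K →ₗ[F] K) ∘ₗ
        ((h.symm : K →ₗ[F] K) ∘ₗ f ∘ₗ (g.symm : K →ₗ[F] K)) ∘ₗ (g : K →ₗ[F] K) = f := by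
      ext x
      simp
    have h6 := hf
    rw [← h5, hmem] at h6
    refine ⟨_, (conj (D σ) i).smul_mem (h 1) (mono_comp_mem_conj h6 i), ?_⟩
    rw [LinearEquiv.coe_coe, compRight_apply]
    ext x
    rw [LinearMap.comp_apply, LinearMap.smul_apply, LinearMap.comp_apply, mono_eq_frob, smul_eq_mul,
      ← h4]
    simp
  · rintro ⟨_, ⟨f, hf, rfl⟩, rfl⟩
    have h5 := C'.smul_mem (h 1)⁻¹ ((hmem f).2 hf)
    convert h5 using 1
    ext x
    change frob F K i (f (g x)) = (h 1)⁻¹ * h (f (g x))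
    rw [h4 (f (g x)), inv_mul_cancel_left₀ ha]

theorem eq_smul_id_of_coeffAt {s : ℕ} (hs : s.Coprime (finrank F K)) {φ : K →ₗ[F] K}
    (h : ∀ t, 0 < t → t < finrank F K → coeffAt (s * t) φ = 0) :
    ∃ c : K, φ = c • LinearMap.id := by
  refine ⟨coeffAt 0 φ, ?_⟩
  classical
  rw [← mono_zero, ← sub_eq_zero]
  refine eq_zero_of_coeffAt hs fun t ht => ?_
  rw [map_sub, map_smul]
  rcases Nat.eq_zero_or_pos t with rfl | h0
  · rw [mul_zero, coeffAt_mono_self]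
    simp
  · rw [h t h0 ht, coeffAt_mono, if_neg, smul_zero, sub_zero]
    have := (mul_modEq_iff hs finrank_pos ht (t := 0)).not.2 h0.ne
    rwa [mul_zero] at this

theorem mem_gabidulin {k s : ℕ} (hk : k ≤ finrank F K) (hs : s.Coprime (finrank F K))
    {f : K →ₗ[F] K} :
    f ∈ gabidulin F K k s ↔ ∀ t < finrank F K, k ≤ t → coeffAt (s * t) f = 0 := by
  rw [gabidulin_eq_supportCode, mem_supportCode hs (Finset.range_subset_range.2 hk)]
  simp

theorem finrank_gabidulin {k s : ℕ} (hk : k ≤ finrank F K) (hs : s.Coprime (finrank F K)) :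
    finrank K (gabidulin F K k s) = k := by
  rw [gabidulin_eq_supportCode, finrank_supportCode hs (Finset.range_subset_range.2 hk),
    Finset.card_range]

omit [Finite K] in
theorem mono_mem_gabidulin {k s t : ℕ} (ht : t < k) : mono F K (s * t) ∈ gabidulin F K k s :=
  Submodule.subset_span ⟨t, ht, rfl⟩

theorem twist_mem_gabidulin {k s : ℕ} (hk : k ≤ finrank F K) (hs : s.Coprime (finrank F K))
    (σ : K ≃+* K) (f : K →ₗ[F] K) :
    twist σ f ∈ gabidulin F K k s ↔ f ∈ gabidulin F K k s := by
  simp [mem_gabidulin hk hs, coeffAt_twist]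

/-- Any coefficient of `φ` at a position `t ≠ 0` can be moved by some `x^[su]`, `u < k`, into the
range from `k` to `n - 1`, where codewords vanish. This range is nonempty because `k < n`. -/
theorem idealizer_gabidulin {k s : ℕ} (hk0 : 1 ≤ k) (hk : k < finrank F K)
    (hs : s.Coprime (finrank F K)) {φ : K →ₗ[F] K}
    (hφ : ∀ f ∈ gabidulin F K k s, φ ∘ₗ f ∈ gabidulin F K k s) :
    ∃ c : K, φ = c • LinearMap.id := by
  refine eq_smul_id_of_coeffAt hs fun t ht0 ht => ?_
  have key : ∀ u < k, k ≤ t + u → t + u < finrank F K → coeffAt (s * t) φ = 0 := by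
    intro u hu h1 h2
    have := (mem_gabidulin hk.le hs).1 (hφ _ (mono_mem_gabidulin hu)) (t + u) h2 h1
    rwa [mul_add, coeffAt_comp_mono] at this
  rcases Nat.lt_or_ge t k with h | h
  · exact key (k - t) (by omega) (by omega) (by omega)
  · exact key 0 (by omega) (by omega) (by omega)

theorem Equivalent.exists_of_gabidulin {k s : ℕ} (hk0 : 1 ≤ k) (hk : k < finrank F K)
    (hs : s.Coprime (finrank F K)) {C : Submodule K (K →ₗ[F] K)}
    (h : Equivalent (gabidulin F K k s) C) :
    ∃ (i : ℕ) (g : K ≃ₗ[F] K),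
      C = (conj (gabidulin F K k s) i).map (compRight g).toLinearMap := by
  obtain ⟨-, i, g, hC⟩ := h.exists_conj_map (fun _ => gabidulin F K k s)
    (twist_mem_gabidulin hk.le hs) fun _ _ => idealizer_gabidulin hk0 hk hs
  exact ⟨i, g, hC⟩

/-- The linearized monomials as invertible maps. -/
noncomputable def monoEquiv (F K : Type*) [Field F] [Fintype F] [Field K] [Finite K] [Algebra F K]
    (i : ℕ) : K ≃ₗ[F] K :=
  LinearEquiv.ofBijective (mono F K i) ⟨(frob F K i).toRingHom.injective, frob_surjective i⟩

theorem coe_monoEquiv (i : ℕ) : (monoEquiv F K i : K →ₗ[F] K) = mono F K i := rfl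

theorem IsGenGabidulin.conj {G : Submodule K (K →ₗ[F] K)} (hG : IsGenGabidulin G) (i : ℕ) :
    IsGenGabidulin (conj G i) := by
  obtain ⟨k, s, hk0, hk, hs, h, g, σ, hC⟩ := hG
  refine ⟨k, s, hk0, hk, hs, h.trans (monoEquiv F K i), g, σ, ?_⟩
  change _ = (fun f : K →ₗ[F] K => mono F K i ∘ₗ f) '' (G : Set (K →ₗ[F] K))
  rw [← hC, Set.image_image]
  rfl

theorem IsGenGabidulin.map {G : Submodule K (K →ₗ[F] K)} (hG : IsGenGabidulin G)
    (g : K ≃ₗ[F] K) : IsGenGabidulin (G.map (compRight g).toLinearMap) := by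
  obtain ⟨k, s, hk0, hk, hs, h, g', σ, hC⟩ := hG
  refine ⟨k, s, hk0, hk, hs, h, g.trans g', σ, ?_⟩
  rw [Submodule.map_coe, ← hC, Set.image_image]
  rfl

/-- Turns an abstract Gabidulin subcode into a chain of conjugates of one invertible map. The full
space has to be excluded, because its left idealizer is everything. -/
theorem IsGenGabidulin.exists_comp_mem {G : Submodule K (K →ₗ[F] K)} (hG : IsGenGabidulin G)
    (hlt : finrank K G < finrank F K) :
    ∃ (s : ℕ) (g : K ≃ₗ[F] K), s.Coprime (finrank F K) ∧
      ∀ t < finrank K G, mono F K (s * t) ∘ₗ (g : K →ₗ[F] K) ∈ G := by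
  obtain ⟨k, s, hk0, hk, hs, hC⟩ := hG
  have hfr := hC.finrank_eq
  rw [finrank_gabidulin hk hs] at hfr
  rw [hfr] at hlt ⊢
  obtain ⟨i, g, rfl⟩ := hC.exists_of_gabidulin hk0 hlt hs
  refine ⟨s, g.trans (monoEquiv F K i), hs, fun t ht =>
    ⟨_, mono_comp_mem_conj (mono_mem_gabidulin ht) i, ?_⟩⟩
  rw [LinearEquiv.coe_coe, compRight_apply, mono_comp_mono, add_comm, ← mono_comp_mono]
  rfl

omit [Fintype F] [Finite K] in
theorem finrank_map_compRight (C : Submodule K (K →ₗ[F] K)) (g : K ≃ₗ[F] K) :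
    finrank K (C.map (compRight g).toLinearMap) = finrank K C :=
  LinearEquiv.finrank_map_eq _ _

theorem isGenGabidulin_gabidulin {k s : ℕ} (hk0 : 1 ≤ k) (hk : k ≤ finrank F K)
    (hs : s.Coprime (finrank F K)) : IsGenGabidulin (gabidulin F K k s) := by
  refine ⟨k, s, hk0, hk, hs, LinearEquiv.refl F K, LinearEquiv.refl F K, RingEquiv.refl K, ?_⟩
  have : (fun f : K →ₗ[F] K => ((LinearEquiv.refl F K : K ≃ₗ[F] K) : K →ₗ[F] K) ∘ₗ
      twist (RingEquiv.refl K) f ∘ₗ ((LinearEquiv.refl F K : K ≃ₗ[F] K) : K →ₗ[F] K)) = id := by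
    funext f
    rw [twist_refl]
    rfl
  rw [this, Set.image_id]

theorem le_gabidulinIndex_of_le {C G : Submodule K (K →ₗ[F] K)} (hG : IsGenGabidulin G)
    (hle : G ≤ C) : finrank K G ≤ gabidulinIndex C := by
  refine le_csSup ⟨finrank K C, ?_⟩ ⟨G, hle, hG, rfl⟩
  rintro _ ⟨G', hG', -, rfl⟩
  exact Submodule.finrank_mono hG'

theorem le_gabidulinIndex {C : Submodule K (K →ₗ[F] K)} {m s : ℕ} (hm0 : 1 ≤ m)
    (hm : m ≤ finrank F K) (hs : s.Coprime (finrank F K)) (g : K ≃ₗ[F] K)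
    (h : ∀ t < m, mono F K (s * t) ∘ₗ (g : K →ₗ[F] K) ∈ C) : m ≤ gabidulinIndex C := by
  have := le_gabidulinIndex_of_le (C := C) ((isGenGabidulin_gabidulin hm0 hm hs).map g) (by
    rw [Submodule.map_le_iff_le_comap]
    refine Submodule.span_le.2 ?_
    rintro _ ⟨t, ht, rfl⟩
    exact h t ht)
  rwa [finrank_map_compRight, finrank_gabidulin hm hs] at this

/-- A Gabidulin subcode of dimension above `m` would supply a chain with `m + 1` members, which is
why `t = m` is included. -/
theorem gabidulinIndex_le {C : Submodule K (K →ₗ[F] K)} {m : ℕ} (hC : finrank K C < finrank F K)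
    (h : ∀ (s : ℕ) (g : K ≃ₗ[F] K), s.Coprime (finrank F K) →
      ¬ ∀ t ≤ m, mono F K (s * t) ∘ₗ (g : K →ₗ[F] K) ∈ C) : gabidulinIndex C ≤ m := by
  refine csSup_le' ?_
  rintro _ ⟨G, hGC, hG, rfl⟩
  by_contra hlt
  obtain ⟨s, g, hs, hg⟩ := hG.exists_comp_mem ((Submodule.finrank_mono hGC).trans_lt hC)
  exact h s g hs fun t ht => hGC (hg t (by omega))

/-- Dropping the first member of a chain of length `h + 2` leaves `h + 1` independent elements of `C
∩ C^[s]`, a contradiction. -/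
theorem gabidulinIndex_le_hIndex_add_one {C : Submodule K (K →ₗ[F] K)}
    (hC : finrank K C < finrank F K) (hn : 1 < finrank F K) :
    gabidulinIndex C ≤ hIndex C + 1 := by
  refine gabidulinIndex_le hC fun s g hs h => ?_
  have h1 : (gabidulin F K (hIndex C + 1) s).map
      (compRight (g.trans (monoEquiv F K s))).toLinearMap ≤ C ⊓ RankMetric.conj C s := by
    rw [Submodule.map_le_iff_le_comap]
    refine Submodule.span_le.2 ?_
    rintro _ ⟨t, ht, rfl⟩
    change mono F K (s * t) ∘ₗ mono F K s ∘ₗ (g : K →ₗ[F] K) ∈ C ⊓ RankMetric.conj C s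
    rw [← LinearMap.comp_assoc, mono_comp_mono]
    refine ⟨h (t + 1) ht, ?_⟩
    rw [add_comm, ← mono_comp_mono, LinearMap.comp_assoc]
    exact mono_comp_mem_conj (h t ht.le) s
  have h2 := Submodule.finrank_mono h1
  have h3 := hIndex_le_finrank C
  rw [finrank_map_compRight, finrank_gabidulin (by omega) hs] at h2
  have h4 := finrank_inf_conj_le_hIndex C hn hs
  omega

theorem hIndex_conj (C : Submodule K (K →ₗ[F] K)) (i : ℕ) :
    hIndex (RankMetric.conj C i) = hIndex C := by
  unfold hIndex
  refine Finset.sup_congr rfl fun j _ => ?_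
  rw [conj_conj, add_comm, ← conj_conj, ← conj_inf, finrank_conj]

theorem hIndex_map (C : Submodule K (K →ₗ[F] K)) (g : K ≃ₗ[F] K) :
    hIndex (C.map (compRight g).toLinearMap) = hIndex C := by
  unfold hIndex
  refine Finset.sup_congr rfl fun j _ => ?_
  rw [conj_map_compRight, ← Submodule.map_inf _ (compRight g).injective, finrank_map_compRight]

theorem conj_mono {C D : Submodule K (K →ₗ[F] K)} (h : C ≤ D) (i : ℕ) :
    RankMetric.conj C i ≤ RankMetric.conj D i :=
  Set.image_mono h

theorem gabidulinIndex_conj_le (C : Submodule K (K →ₗ[F] K)) (i : ℕ) :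
    gabidulinIndex C ≤ gabidulinIndex (RankMetric.conj C i) := by
  refine csSup_le' ?_
  rintro _ ⟨G, hGC, hG, rfl⟩
  rw [← finrank_conj G i]
  exact le_gabidulinIndex_of_le (hG.conj i) (conj_mono hGC i)

theorem gabidulinIndex_conj (C : Submodule K (K →ₗ[F] K)) (i : ℕ) :
    gabidulinIndex (RankMetric.conj C i) = gabidulinIndex C := by
  refine le_antisymm ?_ (gabidulinIndex_conj_le C i)
  obtain ⟨i', hi'⟩ := exists_add_modEq_zero (finrank_pos (R := F) (M := K)) i
  have := gabidulinIndex_conj_le (RankMetric.conj C i) i'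
  rwa [conj_conj, conj_congr C hi', conj_zero] at this

theorem gabidulinIndex_map_le (C : Submodule K (K →ₗ[F] K)) (g : K ≃ₗ[F] K) :
    gabidulinIndex C ≤ gabidulinIndex (C.map (compRight g).toLinearMap) := by
  refine csSup_le' ?_
  rintro _ ⟨G, hGC, hG, rfl⟩
  rw [← finrank_map_compRight G g]
  exact le_gabidulinIndex_of_le (hG.map g) (Submodule.map_mono hGC)

theorem gabidulinIndex_map (C : Submodule K (K →ₗ[F] K)) (g : K ≃ₗ[F] K) :
    gabidulinIndex (C.map (compRight g).toLinearMap) = gabidulinIndex C := by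
  refine le_antisymm ?_ (gabidulinIndex_map_le C g)
  have := gabidulinIndex_map_le (C.map (compRight g).toLinearMap) g.symm
  rw [← Submodule.map_comp] at this
  have h : (compRight g.symm).toLinearMap ∘ₗ (compRight g).toLinearMap = LinearMap.id := by
    ext f x
    simp [compRight_apply]
  rwa [h, Submodule.map_id] at this

theorem HasIndexes.conj_map {C : Submodule K (K →ₗ[F] K)} {k m h : ℕ} (hC : HasIndexes C k m h)
    (i : ℕ) (g : K ≃ₗ[F] K) :
    HasIndexes ((RankMetric.conj C i).map (compRight g).toLinearMap) k m h := by
  obtain ⟨h1, h2, h3⟩ := hC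
  exact ⟨by rw [finrank_map_compRight, finrank_conj, h1],
    by rw [gabidulinIndex_map, gabidulinIndex_conj, h2], by rw [hIndex_map, hIndex_conj, h3]⟩

/-- The three indices when `ind(C) = h(C) + 1`. -/
theorem hasIndexes_of_mono_comp_mem {C : Submodule K (K →ₗ[F] K)} {k m s : ℕ}
    (hn : 1 < finrank F K) (hk : finrank K C = k) (hkn : k < finrank F K) (hh : hIndex C = m)
    (hs : s.Coprime (finrank F K)) (g : K ≃ₗ[F] K)
    (h : ∀ t < m + 1, mono F K (s * t) ∘ₗ (g : K →ₗ[F] K) ∈ C) : HasIndexes C k (m + 1) m := by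
  have h1 := hIndex_le_finrank C
  refine ⟨hk, le_antisymm ?_ (le_gabidulinIndex (by omega) (by omega) hs g h), hh⟩
  rw [← hh]
  exact gabidulinIndex_le_hIndex_add_one (by omega) hn

theorem hIndex_supportCode {s m : ℕ} (hn : 1 < finrank F K) (hs : s.Coprime (finrank F K))
    {S : Finset ℕ} (hS : S ⊆ Finset.range (finrank F K))
    (hle : ∀ j, 0 < j → j < finrank F K → j.Coprime (finrank F K) →
      {t ∈ S | (t + (finrank F K - j)) % finrank F K ∈ S}.card ≤ m)
    (hge : m ≤ {t ∈ S | (t + (finrank F K - 1)) % finrank F K ∈ S}.card) :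
    hIndex (supportCode F K s S) = m := by
  have key : ∀ j ≤ finrank F K,
      finrank K (supportCode F K s S ⊓ conj (supportCode F K s S) (s * j) :
        Submodule K (K →ₗ[F] K)) = {t ∈ S | (t + (finrank F K - j)) % finrank F K ∈ S}.card := by
    intro j hj
    rw [supportCode_inf_conj hs hj hS, finrank_supportCode hs ((Finset.filter_subset _ _).trans hS)]
  refine hIndex_eq hn hs (fun j h0 hj hjc => (key j hj.le).trans_le (hle j h0 hj hjc)) ?_
  have := key 1 hn.le
  rw [mul_one] at this
  rwa [this]

/-- For a monomial code everything is combinatorial: overlaps of the support with its translates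
bound `h`, and a run of `m + 1` consecutive positions from `a` on is a Gabidulin subcode. -/
theorem hasIndexes_supportCode {s k m a : ℕ} (hn : 1 < finrank F K) (hs : s.Coprime (finrank F K))
    {S : Finset ℕ} (hS : S ⊆ Finset.range (finrank F K)) (hk : S.card = k)
    (hkn : k < finrank F K)
    (hle : ∀ j, 0 < j → j < finrank F K → j.Coprime (finrank F K) →
      {t ∈ S | (t + (finrank F K - j)) % finrank F K ∈ S}.card ≤ m)
    (hge : m ≤ {t ∈ S | (t + (finrank F K - 1)) % finrank F K ∈ S}.card)
    (ha : ∀ t < m + 1, t + a ∈ S) : HasIndexes (supportCode F K s S) k (m + 1) m := by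
  refine hasIndexes_of_mono_comp_mem hn (by rw [finrank_supportCode hs hS, hk]) hkn
    (hIndex_supportCode hn hs hS hle hge) hs (monoEquiv F K (s * a)) fun t ht => ?_
  rw [coe_monoEquiv, mono_comp_mono, ← mul_add]
  exact mono_mem_supportCode (ha t ht)

theorem hasIndexes_gabidulin {k s : ℕ} (hk0 : 1 ≤ k) (hk : k < finrank F K)
    (hs : s.Coprime (finrank F K)) : HasIndexes (gabidulin F K k s) k k (k - 1) := by
  rw [gabidulin_eq_supportCode]
  obtain ⟨k, rfl⟩ : ∃ m, k = m + 1 := ⟨k - 1, by omega⟩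
  refine hasIndexes_supportCode (by omega) hs (Finset.range_subset_range.2 hk.le)
    (Finset.card_range _) hk (fun j h0 hj _ => ?_) ?_ (a := 0) fun t ht => Finset.mem_range.2 ht
  -- A proper interval of `ℤ/n` is not stable under a nonzero translation: some point lands on `k +
  -- 1` exactly, or `0` already lands beyond the interval.
  · obtain ⟨t, ht, h⟩ : ∃ t < k + 1, ¬ (t + (finrank F K - j)) % finrank F K < k + 1 := by
      rcases Nat.lt_or_ge (finrank F K - j) (k + 1) with h | h
      · refine ⟨k + 1 - (finrank F K - j), by omega, ?_⟩
        rw [Nat.mod_eq_of_lt (by omega)]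
        omega
      · refine ⟨0, by omega, ?_⟩
        rw [Nat.mod_eq_of_lt (by omega)]
        omega
    have hss : {t ∈ Finset.range (k + 1) | (t + (finrank F K - j)) % finrank F K ∈
        Finset.range (k + 1)} ⊂ Finset.range (k + 1) :=
      Finset.filter_ssubset.2 ⟨t, Finset.mem_range.2 ht, by rwa [Finset.mem_range]⟩
    have := Finset.card_lt_card hss
    rw [Finset.card_range] at this
    omega
  · have hsub : Finset.Ico 1 (k + 1) ⊆ {t ∈ Finset.range (k + 1) |
        (t + (finrank F K - 1)) % finrank F K ∈ Finset.range (k + 1)} := by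
      intro t ht
      rw [Finset.mem_Ico] at ht
      rw [Finset.mem_filter, Finset.mem_range, Finset.mem_range]
      refine ⟨ht.2, ?_⟩
      rw [show t + (finrank F K - 1) = t - 1 + finrank F K by omega, Nat.add_mod_right,
        Nat.mod_eq_of_lt (by omega)]
      omega
    simpa using Finset.card_le_card hsub

end Equivalence

/-! ### Twisted Gabidulin codes -/

section Twisted

variable {F K : Type*} [Field F] [Fintype F] [Field K] [Finite K] [Algebra F K]

omit [Finite K] in
theorem mono_mem_twistedGabidulin {k s t : ℕ} {η : K} (h1 : 1 ≤ t) (ht : t < k) :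
    mono F K (s * t) ∈ twistedGabidulin F k s η :=
  Submodule.subset_span (Or.inr ⟨t, h1, ht, rfl⟩)

theorem mem_twistedGabidulin {k s : ℕ} {η : K} (hk0 : 0 < k) (hk : k < finrank F K)
    (hs : s.Coprime (finrank F K)) {f : K →ₗ[F] K} :
    f ∈ twistedGabidulin F k s η ↔
      (∀ t < finrank F K, k < t → coeffAt (s * t) f = 0) ∧
        coeffAt (s * k) f = η * coeffAt (s * 0) f := by
  classical
  have hmono : ∀ {t u}, t < finrank F K → u < finrank F K →
      coeffAt (s * u) (mono F K (s * t)) = if t = u then (1 : K) else 0 :=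
    fun ht hu => coeffAt_mono_mul hs ht hu
  have hm0 : mono F K 0 = mono F K (s * 0) := by rw [mul_zero]
  have hpos : 0 < finrank F K := finrank_pos
  constructor
  · intro hf
    induction hf using Submodule.span_induction with
    | mem x hx =>
      rcases hx with rfl | ⟨t, h1, ht, rfl⟩
      · rw [hm0]
        refine ⟨fun u hu hku => ?_, ?_⟩
        · rw [map_add, map_smul, hmono hpos hu, hmono hk hu, if_neg (by omega), if_neg (by omega)]
          simp
        · rw [map_add, map_smul, map_add, map_smul, hmono hpos hk, hmono hk hk, hmono hpos hpos,
            hmono hk hpos, if_neg hk0.ne, if_neg hk0.ne']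
          simp
      · refine ⟨fun u hu hku => ?_, ?_⟩
        · rw [hmono (by omega) hu, if_neg (by omega)]
        · rw [hmono (by omega) hk, if_neg (by omega), hmono (by omega) hpos, if_neg (by omega),
            mul_zero]
    | zero => simp
    | add x y _ _ hx hy =>
      refine ⟨fun t ht hkt => ?_, ?_⟩
      · rw [map_add, hx.1 t ht hkt, hy.1 t ht hkt, add_zero]
      · rw [map_add, map_add, hx.2, hy.2, mul_add]
    | smul a x _ hx =>
      refine ⟨fun t ht hkt => ?_, ?_⟩
      · rw [map_smul, hx.1 t ht hkt, smul_zero]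
      · rw [map_smul, map_smul, hx.2, smul_eq_mul, smul_eq_mul, mul_left_comm]
  · rintro ⟨h1, h2⟩
    set v := mono F K 0 + η • mono F K (s * k) with hv
    have hvmem : v ∈ twistedGabidulin F k s η := Submodule.subset_span (Or.inl rfl)
    have h3 : f - coeffAt (s * 0) f • v ∈ supportCode F K s (Finset.Ico 1 k) := by
      rw [mem_supportCode hs fun t ht => Finset.mem_range.2 ((Finset.mem_Ico.1 ht).2.trans hk)]
      intro t ht htS
      rw [Finset.mem_Ico] at htS
      rw [map_sub, map_smul, hv, hm0, map_add, map_smul, hmono hpos ht, hmono hk ht]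
      rcases Nat.lt_trichotomy t k with h | rfl | h
      · obtain rfl : t = 0 := by omega
        simp [hk0.ne']
      · rw [h2]
        simp [hk0.ne, mul_comm]
      · rw [h1 t ht h, if_neg (by omega), if_neg (by omega)]
        simp
    have h4 : supportCode F K s (Finset.Ico 1 k) ≤ twistedGabidulin F k s η := by
      refine Submodule.span_le.2 ?_
      rintro _ ⟨t, ht, rfl⟩
      have := Finset.mem_Ico.1 ht
      exact mono_mem_twistedGabidulin this.1 this.2
    have := Submodule.add_mem _ (h4 h3) (Submodule.smul_mem _ (coeffAt (s * 0) f) hvmem)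
    rwa [sub_add_cancel] at this

theorem finrank_twistedGabidulin {k s : ℕ} {η : K} (hk0 : 0 < k) (hk : k < finrank F K)
    (hs : s.Coprime (finrank F K)) : finrank K (twistedGabidulin F k s η) = k := by
  classical
  apply le_antisymm
  · refine (finrank_le_card _ (Finset.range k) s fun f hf h => ?_).trans_eq (Finset.card_range k)
    rw [mem_twistedGabidulin hk0 hk hs] at hf
    refine eq_zero_of_coeffAt hs fun t ht => ?_
    rcases Nat.lt_trichotomy t k with h' | rfl | h'
    · exact h t (Finset.mem_range.2 h')
    · rw [hf.2, h 0 (Finset.mem_range.2 hk0), mul_zero]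
    · exact hf.1 t ht h'
  · have := card_le_finrank_of_dual (twistedGabidulin F k s η)
      (fun t : Fin k => if (t : ℕ) = 0 then mono F K 0 + η • mono F K (s * k)
        else mono F K (s * (t : ℕ))) (fun t => s * (t : ℕ)) (fun t => by
        split_ifs with h
        · exact Submodule.subset_span (Or.inl rfl)
        · exact mono_mem_twistedGabidulin (by omega) t.2) fun t u => by
        have ht := t.2
        have hu := u.2
        have hm0 : mono F K 0 = mono F K (s * 0) := by rw [mul_zero]
        split_ifs with h h' h'
        · subst h'
          rw [hm0, map_add, map_smul, coeffAt_mono_mul hs (by omega) (by omega),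
            coeffAt_mono_mul hs (by omega) (by omega),
            if_pos h.symm, if_neg (by omega)]
          simp
        · rw [hm0, map_add, map_smul, coeffAt_mono_mul hs (by omega) (by omega),
            coeffAt_mono_mul hs (by omega) (by omega),
            if_neg (by omega), if_neg (by omega)]
          simp
        · rw [h', coeffAt_mono_self]
        · rw [coeffAt_mono_mul hs (by omega) (by omega), if_neg (by omega)]
    rwa [Fintype.card_fin] at this

theorem twist_mem_twistedGabidulin {k s : ℕ} {η : K} (hk0 : 0 < k) (hk : k < finrank F K)
    (hs : s.Coprime (finrank F K)) (σ : K ≃+* K) (f : K →ₗ[F] K) :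
    twist σ f ∈ twistedGabidulin F k s (σ η) ↔ f ∈ twistedGabidulin F k s η := by
  simp only [mem_twistedGabidulin hk0 hk hs, coeffAt_twist, map_eq_zero_iff σ σ.injective,
    ← map_mul, σ.injective.eq_iff]

/-- Composing `φ` with the monomials `x^[su]`, `1 ≤ u < k`, kills its coefficients at all positions
except `0`, `1` and `n - 1`. The last two are reached by the relation between positions `k` and `0`.
For `k > 2` the partner in that relation is already zero. For `k = 2` the two are partners of each
other, and a nonzero value would make `x^[s]` and `x^[s(n-1)]` the same map. -/
theorem idealizer_twistedGabidulin {k s : ℕ} {η : K} (hη : η ≠ 0) (hk1 : 1 < k) (hk : k + 1 < finrank F K)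
    (hs : s.Coprime (finrank F K)) {φ : K →ₗ[F] K}
    (hφ : ∀ f ∈ twistedGabidulin F k s η, φ ∘ₗ f ∈ twistedGabidulin F k s η) :
    ∃ c : K, φ = c • LinearMap.id := by
  set n := finrank F K with hn
  have hk0 : 0 < k := by omega
  have hmem := fun (c : K) u (h1 : 1 ≤ u) (hu : u < k) => (mem_twistedGabidulin hk0 (by omega) hs).1
    (hφ _ (Submodule.smul_mem _ c (mono_mem_twistedGabidulin (F := F) (s := s) (η := η) h1 hu)))
  have key : ∀ t u, 1 ≤ u → u < k → k < t + u → t + u < n → coeffAt (s * t) φ = 0 := by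
    intro t u h1 hu h2 h3
    have := (hmem 1 u h1 hu).1 (t + u) h3 h2
    rwa [one_smul, mul_add, coeffAt_comp_mono] at this
  have hmid : ∀ t, 1 < t → t + 1 < n → coeffAt (s * t) φ = 0 := by
    intro t h1 h2
    rcases Nat.lt_or_ge k t with h | h
    · exact key t 1 le_rfl hk1 (by omega) (by omega)
    · exact key t (k + 1 - t) (by omega) (by omega) (by omega) (by omega)
  have hwrap : ∀ (c : K) u, 1 ≤ u → u < k → coeffAt (s * (k - u)) φ * frob F K (s * (k - u)) c =
      η * (coeffAt (s * (n - u)) φ * frob F K (s * (n - u)) c) := by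
    intro c u h1 hu
    have h := (hmem c u h1 hu).2
    have e1 : s * k = s * (k - u) + s * u := by rw [← mul_add, Nat.sub_add_cancel hu.le]
    have e2 : s * 0 ≡ s * (n - u) + s * u [MOD n] := by
      rw [← mul_add, Nat.sub_add_cancel (by omega), mul_zero]
      exact (Nat.modEq_zero_iff_dvd.2 (dvd_mul_left _ _)).symm
    rwa [e1, coeffAt_congr e2, coeffAt_comp_smul_mono, coeffAt_comp_smul_mono] at h
  have hfrob : ∀ t, frob F K t 1 = 1 := fun t => map_one _
  have hends : coeffAt (s * 1) φ = 0 ∧ coeffAt (s * (n - 1)) φ = 0 := by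
    rcases Nat.lt_or_ge 2 k with h2 | h2
    · constructor
      · have h := hwrap 1 (k - 1) (by omega) (by omega)
        rw [hmid (n - (k - 1)) (by omega) (by omega), hfrob, show k - (k - 1) = 1 by omega] at h
        simpa using h
      · have h := hwrap 1 1 le_rfl hk1
        rw [hmid (k - 1) (by omega) (by omega), zero_mul, hfrob, mul_one, eq_comm] at h
        exact (mul_eq_zero.1 h).resolve_left hη
    · obtain rfl : k = 2 := by omega
      have h := hwrap 1 1 le_rfl hk1
      rw [hfrob, hfrob, mul_one, mul_one] at h
      have h1 : coeffAt (s * 1) φ = 0 := by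
        by_contra h1
        have h3 : mono F K (s * 1) = mono F K (s * (n - 1)) := by
          ext c
          have h4 := hwrap c 1 le_rfl hk1
          rw [← mul_assoc, ← h] at h4
          exact mul_left_cancel₀ h1 h4
        have h4 := coeffAt_mono_mul (F := F) (K := K) hs (t := n - 1) (u := 1) (by omega) (by omega)
        rw [← h3, coeffAt_mono_self, if_neg (by omega)] at h4
        exact one_ne_zero h4
      refine ⟨h1, ?_⟩
      rw [show 2 - 1 = 1 from rfl, h1, eq_comm] at h
      exact (mul_eq_zero.1 h).resolve_left hη
  refine eq_smul_id_of_coeffAt hs fun t ht0 ht => ?_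
  by_cases h1 : t = 1
  · rw [h1, hends.1]
  by_cases h2 : t = n - 1
  · rw [h2, hends.2]
  exact hmid t (by omega) (by omega)

/-- In a conjugate code the factor `η` is replaced by a conjugate, so the relation between positions
`k + j` and `j` is kept only as equivalence of vanishing. Positions are read modulo `n`. -/
theorem coeffAt_of_mem_conj_twistedGabidulin {k s j : ℕ} {η : K} (hη : η ≠ 0) (hk0 : 0 < k)
    (hk : k < finrank F K) (hs : s.Coprime (finrank F K)) (hj : j ≤ finrank F K) {f : K →ₗ[F] K}
    (hf : f ∈ conj (twistedGabidulin F k s η) (s * j)) :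
    (∀ t < finrank F K, k < t → coeffAt (s * (t + j)) f = 0) ∧
      (coeffAt (s * j) f = 0 → coeffAt (s * (k + j)) f = 0) ∧
      (coeffAt (s * (k + j)) f = 0 → coeffAt (s * j) f = 0) := by
  have h0 : s * j + s * (finrank F K - j) ≡ 0 [MOD finrank F K] := by
    rw [← mul_add, Nat.add_sub_of_le hj]
    exact Nat.modEq_zero_iff_dvd.2 (dvd_mul_left _ _)
  rw [mem_conj_iff h0, mem_twistedGabidulin hk0 hk hs] at hf
  have key : ∀ t, coeffAt (s * t) (mono F K (s * (finrank F K - j)) ∘ₗ f) =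
      frob F K (s * (finrank F K - j)) (coeffAt (s * (t + j)) f) := fun t => by
    rw [← coeffAt_mono_comp, coeffAt_congr]
    rw [← mul_add, add_assoc, Nat.add_sub_of_le hj, mul_add]
    exact (Nat.modEq_zero_iff_dvd.2 (dvd_mul_left _ _)).symm.add_left (s * t)
  simp only [key, map_eq_zero, zero_add] at hf
  refine ⟨hf.1, fun h => ?_, fun h => ?_⟩
  · have := hf.2
    rwa [h, map_zero, mul_zero, map_eq_zero] at this
  · have := hf.2
    rw [h, map_zero, eq_comm, mul_eq_zero, map_eq_zero] at this
    exact this.resolve_left hη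

theorem finrank_twistedGabidulin_inf_conj_le {k s j : ℕ} {η : K} (hη : η ≠ 0) (hk1 : 1 < k)
    (hk : k + 1 < finrank F K) (hs : s.Coprime (finrank F K)) (hj0 : 0 < j)
    (hj : 2 * j < finrank F K) :
    finrank K (twistedGabidulin F k s η ⊓ conj (twistedGabidulin F k s η) (s * j) :
      Submodule K (K →ₗ[F] K)) ≤ k - 2 := by
  set n := finrank F K with hn
  have hper : ∀ (f : K →ₗ[F] K) i i', i' + n = i → coeffAt (s * i') f = coeffAt (s * i) f := by
    rintro f i i' rfl
    rw [coeffAt_congr]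
    rw [mul_add]
    exact (Nat.modEq_zero_iff_dvd.2 (dvd_mul_left _ _)).symm.add_left (s * i')
  rcases Nat.lt_or_ge n (j + k) with hjk | hjk
  -- The translated support wraps around, and `r` is `k + j` modulo `n`. Position `r + 1` vanishes
  -- as the image of `k + 1`. Position `j`, which is below `k` because `2j < n < j + k`, is
  -- prescribed or equal to `r + 1`, and its vanishing forces that of `r`.
  · set r := j + k - n with hr
    have hcard : ((Finset.range k).erase r |>.erase (r + 1)).card = k - 2 := by
      rw [Finset.card_erase_of_mem, Finset.card_erase_of_mem, Finset.card_range]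
      · omega
      · rw [Finset.mem_range]; omega
      · rw [Finset.mem_erase, Finset.mem_range]; omega
    rw [← hcard]
    refine finrank_le_card _ _ s fun f hf h => eq_zero_of_coeffAt hs ?_
    obtain ⟨hf1, hf2⟩ := Submodule.mem_inf.1 hf
    rw [mem_twistedGabidulin (by omega) (by omega) hs] at hf1
    obtain ⟨b1, b2, -⟩ := coeffAt_of_mem_conj_twistedGabidulin hη (by omega) (by omega) hs
      (by omega) hf2
    have hT : ∀ t < k, t ≠ r → t ≠ r + 1 → coeffAt (s * t) f = 0 := fun t h1 h2 h3 =>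
      h t (Finset.mem_erase.2 ⟨h3, Finset.mem_erase.2 ⟨h2, Finset.mem_range.2 h1⟩⟩)
    have hr1 : coeffAt (s * (r + 1)) f = 0 := by
      rw [hper f (k + 1 + j) (r + 1) (by omega)]
      exact b1 (k + 1) (by omega) (by omega)
    have hcj : coeffAt (s * j) f = 0 := by
      by_cases h1 : j = r + 1
      · rw [h1, hr1]
      · exact hT j (by omega) (by omega) h1
    have hr0 : coeffAt (s * r) f = 0 := by
      rw [hper f (k + j) r (by omega)]
      exact b2 hcj
    intro t ht
    rcases Nat.lt_trichotomy t k with h' | rfl | h'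
    · by_cases h1 : t = r
      · rw [h1, hr0]
      by_cases h2 : t = r + 1
      · rw [h2, hr1]
      exact hT t h' h1 h2
    · rw [hf1.2, hT 0 (by omega) (by omega) (by omega), mul_zero]
    · exact hf1.1 t ht h'
  -- Without wrapping, positions `0` and `1` are the two that the conjugate code forces to vanish.
  · have hcard : (Finset.Ico 2 k).card = k - 2 := Nat.card_Ico _ _
    rw [← hcard]
    refine finrank_le_card _ _ s fun f hf h => eq_zero_of_coeffAt hs ?_
    obtain ⟨hf1, hf2⟩ := Submodule.mem_inf.1 hf
    rw [mem_twistedGabidulin (by omega) (by omega) hs] at hf1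
    obtain ⟨b1, b2, b3⟩ := coeffAt_of_mem_conj_twistedGabidulin hη (by omega) (by omega) hs
      (by omega) hf2
    have h1 : coeffAt (s * 1) f = 0 := by
      rcases Nat.lt_or_ge 1 j with hj1 | hj1
      · rw [hper f (n + 1 - j + j) 1 (by omega)]
        exact b1 _ (by omega) (by omega)
      · obtain rfl : j = 1 := by omega
        exact b3 (hf1.1 _ (by omega) (by omega))
    have h0 : coeffAt (s * 0) f = 0 := by
      rcases Nat.lt_or_ge (j + k) n with hjk' | hjk'
      · rw [hper f (n - j + j) 0 (by omega)]
        exact b1 _ (by omega) (by omega)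
      · rw [hper f (k + j) 0 (by omega)]
        exact b2 (h j (Finset.mem_Ico.2 (by omega)))
    intro t ht
    rcases Nat.lt_trichotomy t k with h' | rfl | h'
    · match t with
      | 0 => exact h0
      | 1 => exact h1
      | t + 2 => exact h _ (Finset.mem_Ico.2 (by omega))
    · rw [hf1.2, h0, mul_zero]
    · exact hf1.1 t ht h'

/-- The symmetry `j ↔ n - j` leaves `2j < n`, since `2j = n` contradicts coprimality for `n > 2`.
The bound is attained at `x^[s]` by the monomials at positions `2, …, k - 1`. -/
theorem hIndex_twistedGabidulin {k s : ℕ} {η : K} (hη : η ≠ 0) (hk1 : 1 < k)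
    (hk : k + 1 < finrank F K) (hs : s.Coprime (finrank F K)) :
    hIndex (twistedGabidulin F k s η) = k - 2 := by
  refine hIndex_eq (by omega) hs (fun j hj0 hj hjc => ?_) ?_
  · rcases Nat.lt_trichotomy (2 * j) (finrank F K) with h | h | h
    · exact finrank_twistedGabidulin_inf_conj_le hη hk1 hk hs hj0 h
    · rw [← h, Nat.Coprime, Nat.gcd_mul_left_right] at hjc
      omega
    · rw [finrank_inf_conj_symm _ (j' := s * (finrank F K - j))]
      · exact finrank_twistedGabidulin_inf_conj_le hη hk1 hk hs (by omega) (by omega)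
      · rw [← mul_add, Nat.add_sub_of_le hj.le]
        exact Nat.modEq_zero_iff_dvd.2 (dvd_mul_left _ _)
  · have h1 : supportCode F K s (Finset.Ico 2 k) ≤
        twistedGabidulin F k s η ⊓ conj (twistedGabidulin F k s η) s := by
      refine Submodule.span_le.2 ?_
      rintro _ ⟨t, ht, rfl⟩
      obtain ⟨h2, h3⟩ := Finset.mem_Ico.1 ht
      refine ⟨mono_mem_twistedGabidulin (by omega) h3, ?_⟩
      obtain ⟨t, rfl⟩ : ∃ u, t = 1 + u := ⟨t - 1, by omega⟩
      change mono F K (s * (1 + t)) ∈ conj _ s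
      rw [mul_add, mul_one, ← mono_comp_mono]
      exact mono_comp_mem_conj (mono_mem_twistedGabidulin (by omega) (by omega)) s
    have h2 := Submodule.finrank_mono h1
    rwa [finrank_supportCode hs fun t ht => Finset.mem_range.2 (by
      have := Finset.mem_Ico.1 ht; omega), Nat.card_Ico] at h2

theorem hasIndexes_twistedGabidulin {k s : ℕ} {η : K} (hη : η ≠ 0) (hk1 : 1 < k)
    (hk : k + 1 < finrank F K) (hs : s.Coprime (finrank F K)) :
    HasIndexes (twistedGabidulin F k s η) k (k - 1) (k - 2) := by
  rw [show k - 1 = k - 2 + 1 by omega]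
  refine hasIndexes_of_mono_comp_mem (by omega) (finrank_twistedGabidulin (by omega) (by omega) hs)
    (by omega) (hIndex_twistedGabidulin hη hk1 hk hs) hs (monoEquiv F K s) fun t ht => ?_
  rw [coe_monoEquiv, mono_comp_mono, show s * t + s = s * (t + 1) by ring]
  exact mono_mem_twistedGabidulin (by omega) (by omega)

end Twisted

/-! ### Delsarte duals and the dimension formula -/

section Dual

variable {F K : Type*} [Field F] [Fintype F] [Field K] [Finite K] [Algebra F K]

/-- The pairing `∑ fᵢ gᵢ`. -/
noncomputable def pairing (F K : Type*) [Field F] [Fintype F] [Field K] [Finite K] [Algebra F K] :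
    (K →ₗ[F] K) →ₗ[K] (K →ₗ[F] K) →ₗ[K] K :=
  ∑ i ∈ Finset.range (finrank F K), (LinearMap.lsmul K K).compl₁₂ (coeffAt i) (coeffAt i)

theorem pairing_apply (f g : K →ₗ[F] K) :
    pairing F K f g = ∑ i ∈ Finset.range (finrank F K), coeffAt i f * coeffAt i g := by
  simp [pairing]

theorem pairing_mono (f : K →ₗ[F] K) (a : ℕ) : pairing F K f (mono F K a) = coeffAt a f := by
  rw [pairing_apply, ← coeffAt_mod a, mono_congr (Nat.mod_modEq a (finrank F K)).symm,
    Finset.sum_eq_single (a % finrank F K)]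
  · rw [coeffAt_mono_self, mul_one]
  · intro i hi hia
    rw [coeffAt_mono, if_neg, mul_zero]
    intro h
    rw [Nat.ModEq, Nat.mod_mod, Nat.mod_eq_of_lt (Finset.mem_range.1 hi)] at h
    exact hia h.symm
  · intro h
    exact absurd (Finset.mem_range.2 (Nat.mod_lt _ finrank_pos)) h

/-- A nonzero value of the pairing could be scaled within the `K`-linear code to an element of trace
`1`, so the trace in the definition of the dual may be dropped. -/
theorem mem_dual {C : Submodule K (K →ₗ[F] K)} {f : K →ₗ[F] K} :
    f ∈ dual C ↔ ∀ g ∈ C, pairing F K f g = 0 := by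
  have key : ∀ g, ∑ i, coeff f i * coeff g i = pairing F K f g := by
    intro g
    rw [pairing_apply, Finset.sum_range (fun i => coeffAt i f * coeffAt i g)]
    simp only [coeffAt_val]
  constructor
  · intro h g hg
    by_contra h0
    obtain ⟨y, hy⟩ := Algebra.trace_surjective F K 1
    have h1 : Algebra.trace F K (∑ i, coeff f i * coeff ((y / pairing F K f g) • g) i) = 0 :=
      h _ (C.smul_mem _ hg)
    rw [key, map_smul, smul_eq_mul, div_mul_cancel₀ _ h0, hy] at h1
    exact one_ne_zero h1
  · intro h g hg
    rw [key, h g hg, map_zero]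

theorem mem_dual_span {S : Set (K →ₗ[F] K)} {f : K →ₗ[F] K} :
    f ∈ dual (Submodule.span K S) ↔ ∀ g ∈ S, pairing F K f g = 0 := by
  rw [mem_dual]
  exact Submodule.span_le (p := LinearMap.ker (pairing F K f))

theorem le_finrank_dual (C : Submodule K (K →ₗ[F] K)) :
    finrank F K ≤ finrank K (dual C) + finrank K C := by
  let Φ : (K →ₗ[F] K) →ₗ[K] Module.Dual K C := C.subtype.dualMap ∘ₗ pairing F K
  have hker : LinearMap.ker Φ = dual C := by
    ext f
    rw [mem_dual, LinearMap.mem_ker, LinearMap.ext_iff]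
    exact ⟨fun h g hg => h ⟨g, hg⟩, fun h g => h g g.2⟩
  have h1 := LinearMap.finrank_range_add_finrank_ker Φ
  have h2 := (Submodule.finrank_le (LinearMap.range Φ)).trans_eq
    (Subspace.dual_finrank_eq (K := K) (V := C))
  rw [Module.finrank_linearMap_self, hker] at h1
  omega

/-- Two subspaces of equal dimension in an `n`-dimensional space must meet; this is the lower bound
for `h` of the large sporadic codes. -/
theorem le_finrank_inf_conj (C : Submodule K (K →ₗ[F] K)) (j : ℕ) :
    2 * finrank K C ≤ finrank K (C ⊓ conj C j : Submodule K (K →ₗ[F] K)) + finrank F K := by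
  have h1 := Submodule.finrank_sup_add_finrank_inf_eq C (conj C j)
  have h2 := Submodule.finrank_le (C ⊔ conj C j)
  rw [Module.finrank_linearMap_self] at h2
  rw [finrank_conj] at h1
  omega

theorem dual_supportCode {s : ℕ} (hs : s.Coprime (finrank F K)) {S : Finset ℕ}
    (hS : S ⊆ Finset.range (finrank F K)) :
    dual (supportCode F K s S) = supportCode F K s (Finset.range (finrank F K) \ S) := by
  ext f
  rw [mem_supportCode hs Finset.sdiff_subset, supportCode, mem_dual_span, Set.forall_mem_image]
  simp only [pairing_mono]
  constructor
  · intro h t ht htS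
    refine h (Finset.mem_coe.2 ?_)
    by_contra h'
    exact htS (Finset.mem_sdiff.2 ⟨Finset.mem_range.2 ht, h'⟩)
  · intro h t ht
    exact h t (Finset.mem_range.1 (hS ht)) fun h' => (Finset.mem_sdiff.1 h').2 ht

end Dual

/-! ### The monomial codes for `n = 7` and `n = 8` -/

section Monomial

variable {F K : Type*} [Field F] [Fintype F] [Field K] [Finite K] [Algebra F K]

omit [Finite K] in
theorem C₃₅_eq_supportCode (s : ℕ) : C₃₅ F K s = supportCode F K s {0, 1, 3} := by
  simp [C₃₅, supportCode, Set.image_insert_eq, mul_comm]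

omit [Finite K] in
theorem D₃_eq_supportCode (s : ℕ) : D₃ F K s = supportCode F K s {0, 2, 3, 4} := by
  simp [D₃, supportCode, Set.image_insert_eq, mul_comm]

omit [Finite K] in
theorem D₅_eq_supportCode (s : ℕ) : D₅ F K s = supportCode F K s {0, 2, 3, 4, 5} := by
  simp [D₅, supportCode, Set.image_insert_eq, mul_comm]

theorem hasIndexes_C₃ (hn : finrank F K = 7) {s : ℕ} (hs : s.Coprime 7) :
    HasIndexes (C₃₅ F K s) 3 2 1 ∧ HasIndexes (dual (C₃₅ F K s)) 4 3 2 ∧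
      HasIndexes (D₃ F K s) 4 3 2 := by
  rw [C₃₅_eq_supportCode, D₃_eq_supportCode, dual_supportCode (by rwa [hn]) (by rw [hn]; decide), hn]
  -- The supports `{0,1,3}`, `{2,4,5,6}`, `{0,2,3,4}` contain the runs `0,1`, then `4,5,6`, then
  -- `2,3,4`.
  refine ⟨hasIndexes_supportCode (by omega) (by rwa [hn]) ?_ ?_ (by omega) ?_ ?_ (a := 0) ?_,
    hasIndexes_supportCode (by omega) (by rwa [hn]) ?_ ?_ (by omega) ?_ ?_ (a := 4) ?_,
    hasIndexes_supportCode (by omega) (by rwa [hn]) ?_ ?_ (by omega) ?_ ?_ (a := 2) ?_⟩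
  all_goals (try rw [hn])
  all_goals first
    | decide
    | (intro j h0 hj hjc; interval_cases j <;> revert hjc <;> decide)

theorem hasIndexes_C₅ (hn : finrank F K = 8) {s : ℕ} (hs : s.Coprime 8) :
    HasIndexes (C₃₅ F K s) 3 2 1 ∧ HasIndexes (dual (C₃₅ F K s)) 5 4 3 ∧
      HasIndexes (D₅ F K s) 5 4 3 := by
  rw [C₃₅_eq_supportCode, D₅_eq_supportCode, dual_supportCode (by rwa [hn]) (by rw [hn]; decide), hn]
  -- Here the dual has support `{2,4,5,6,7}`; the runs are `0,1`, then `4,…,7`, then `2,…,5`.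
  refine ⟨hasIndexes_supportCode (by omega) (by rwa [hn]) ?_ ?_ (by omega) ?_ ?_ (a := 0) ?_,
    hasIndexes_supportCode (by omega) (by rwa [hn]) ?_ ?_ (by omega) ?_ ?_ (a := 4) ?_,
    hasIndexes_supportCode (by omega) (by rwa [hn]) ?_ ?_ (by omega) ?_ ?_ (a := 2) ?_⟩
  all_goals (try rw [hn])
  all_goals first
    | decide
    | (intro j h0 hj hjc; interval_cases j <;> revert hjc <;> decide)

end Monomial

/-! ### Tools for codes given by explicit coefficient conditions -/

section Sporadic

variable {F K : Type*} [Field F] [Fintype F] [Field K] [Finite K] [Algebra F K]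

theorem coeffAt_mono_comp_of_le {n a : ℕ} (hn : finrank F K = n) (ha : a ≤ n) (i : ℕ)
    (f : K →ₗ[F] K) :
    coeffAt i (mono F K a ∘ₗ f) = frob F K a (coeffAt ((i + (n - a)) % n) f) := by
  subst hn
  rw [coeffAt_mod, ← coeffAt_mono_comp]
  rw [coeffAt_congr]
  rw [add_assoc, Nat.sub_add_cancel ha]
  exact (Nat.add_mod_right i _).symm

theorem coeffAt_mono_of_finrank {n : ℕ} (hn : finrank F K = n) (i j : ℕ) :
    coeffAt i (mono F K j) = if j % n = i % n then (1 : K) else 0 := by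
  subst hn
  exact coeffAt_mono i j

theorem eq_zero_of_coeffAt_of_finrank {n : ℕ} (hn : finrank F K = n) {f : K →ₗ[F] K}
    (h : ∀ t < n, coeffAt t f = 0) : f = 0 := by
  subst hn
  exact eq_zero_of_coeffAt (s := 1) (Nat.coprime_one_left _) fun t ht => by
    rw [one_mul]
    exact h t ht

theorem finrank_le_of_coeffAt {n m : ℕ} {C : Submodule K (K →ₗ[F] K)} (hn : finrank F K = n)
    (T : Finset ℕ) (hT : T.card = m)
    (h : ∀ f ∈ C, (∀ t ∈ T, coeffAt t f = 0) → ∀ t < n, coeffAt t f = 0) : finrank K C ≤ m := by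
  rw [← hT]
  refine finrank_le_card _ T 1 fun f hf hft => eq_zero_of_coeffAt_of_finrank hn (h f hf ?_)
  simpa only [one_mul] using hft

theorem finrank_inf_conj_le {n m j : ℕ} {C : Submodule K (K →ₗ[F] K)} (hn : finrank F K = n)
    (hj : j ≤ n) (T : Finset ℕ) (hT : T.card = m)
    (h : ∀ f ∈ C, mono F K (n - j) ∘ₗ f ∈ C → (∀ t ∈ T, coeffAt t f = 0) →
      ∀ t < n, coeffAt t f = 0) :
    finrank K (C ⊓ conj C j : Submodule K (K →ₗ[F] K)) ≤ m := by
  refine finrank_le_of_coeffAt hn T hT fun f hf => h f hf.1 ?_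
  rw [← mem_conj_iff (j := j)]
  · exact hf.2
  · rw [Nat.add_sub_of_le hj, hn]
    exact (Nat.modEq_zero_iff_dvd.2 dvd_rfl)

/-- In both alternatives for `m` the lower bound is automatic: trivially, or by the dimension
formula. Only upper bounds remain to be checked. -/
theorem hIndex_eq_of_finrank {n m : ℕ} {C : Submodule K (K →ₗ[F] K)} (hn : finrank F K = n)
    (hn1 : 1 < n) (hm : m = 0 ∨ 2 * finrank K C = m + n)
    (hle : ∀ j, 0 < j → j < n → j.Coprime n →
      finrank K (C ⊓ conj C j : Submodule K (K →ₗ[F] K)) ≤ m) : hIndex C = m := by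
  subst hn
  refine hIndex_eq hn1 (Nat.coprime_one_left _) (fun j => by rw [one_mul]; exact hle j) ?_
  have h1 := le_finrank_inf_conj C 1
  have h2 := hle 1 one_pos hn1 (Nat.coprime_one_left _)
  omega

/-- An upper bound for the Gabidulin index in terms of the coefficients of `g`, where
`g, g^[s], …, g^[ms]` are elements of the code. -/
theorem gabidulinIndex_le_of_coeffAt {n m : ℕ} {C : Submodule K (K →ₗ[F] K)}
    (hn : finrank F K = n) (hC : finrank K C < n)
    (h : ∀ s < n, s.Coprime n → ∀ f, (∀ t ≤ m, mono F K (s * t % n) ∘ₗ f ∈ C) →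
      ∀ t < n, coeffAt t f = 0) : gabidulinIndex C ≤ m := by
  have hpos : 0 < n := hn ▸ finrank_pos
  refine gabidulinIndex_le (by rwa [hn]) fun s g hs hg => ?_
  rw [hn] at hs
  have h0 : (g : K →ₗ[F] K) = 0 := by
    refine eq_zero_of_coeffAt_of_finrank hn (h (s % n) (Nat.mod_lt _ hpos)
      ((coprime_congr (Nat.mod_modEq s n)).2 hs) g fun t ht => ?_)
    rw [Nat.mod_mul_mod, mono_congr (j := s * t) (by rw [hn]; exact Nat.mod_modEq _ _)]
    exact hg t ht
  have := LinearMap.congr_fun h0 1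
  simp at this

/-! ### The codes `C₁`, its dual and `D₁` -/

section First

/-- Necessary conditions suffice, since they serve upper bounds; lower bounds come from explicit
generators. -/
theorem coeffAt_of_mem_C₁ (hn : finrank F K = 6) {δ : K} {f : K →ₗ[F] K} (hf : f ∈ C₁ F δ) :
    coeffAt 2 f = 0 ∧ coeffAt 3 f = 0 ∧ coeffAt 5 f = 0 ∧
      coeffAt 1 f = δ * coeffAt 4 f := by
  induction hf using Submodule.span_induction with
  | mem x hx =>
    rcases hx with rfl | rfl <;> simp [coeffAt_mono_of_finrank hn]
  | zero => simp
  | add x y _ _ hx hy => simp [hx, hy, mul_add]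
  | smul a x _ hx => simp [hx, mul_left_comm]

theorem mem_dual_C₁ {δ : K} {f : K →ₗ[F] K} :
    f ∈ dual (C₁ F δ) ↔ coeffAt 0 f = 0 ∧ δ * coeffAt 1 f + coeffAt 4 f = 0 := by
  simp [C₁, mem_dual_span, pairing_mono]

theorem coeffAt_of_mem_D₁ (hn : finrank F K = 6) {δ : K} {f : K →ₗ[F] K} (hf : f ∈ D₁ F δ) :
    coeffAt 5 f = 0 ∧ coeffAt 3 f = -(δ ^ (Fintype.card F ^ 5) * coeffAt 0 f) := by
  induction hf using Submodule.span_induction with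
  | mem x hx =>
    rcases hx with rfl | rfl | rfl | rfl <;> simp [coeffAt_mono_of_finrank hn]
  | zero => simp
  | add x y _ _ hx hy => simp [hx, hy, mul_add]; ring
  | smul a x _ hx => simp [hx, mul_left_comm]

theorem finrank_C₁ (hn : finrank F K = 6) (δ : K) : finrank K (C₁ F δ) = 2 := by
  apply le_antisymm
  · refine finrank_le_of_coeffAt hn {0, 4} rfl fun f hf h t ht => ?_
    have := coeffAt_of_mem_C₁ hn hf
    interval_cases t <;> simp_all
  · have := card_le_finrank_of_dual (C₁ F δ) ![mono F K 0, δ • mono F K 1 + mono F K 4] ![0, 4]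
      (by intro i; fin_cases i <;> exact Submodule.subset_span (by simp))
      (by intro i j; fin_cases i <;> fin_cases j <;> simp [coeffAt_mono_of_finrank hn])
    simpa using this

theorem hasIndexes_C₁ (hn : finrank F K = 6) (δ : K) :
    HasIndexes (C₁ F δ) 2 1 0 := by
  have h0 : hIndex (C₁ F δ) = 0 := by
    refine hIndex_eq_of_finrank hn (by omega) (Or.inl rfl) fun j h0 hj hjc => ?_
    -- No coordinate has to be prescribed: the conditions from the code and its conjugate already
    -- kill all six.
    refine finrank_inf_conj_le hn hj.le ∅ rfl fun f hf hf' _ t ht => ?_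
    have h1 := coeffAt_of_mem_C₁ hn hf
    have h2 := coeffAt_of_mem_C₁ hn hf'
    clear hf hf'
    interval_cases j <;> first | exact absurd hjc (by decide) | skip
    all_goals
      simp [coeffAt_mono_comp_of_le hn] at h2
      interval_cases t <;> simp_all
  refine hasIndexes_of_mono_comp_mem (s := 1) (by omega) (finrank_C₁ hn δ) (by omega) h0
    (Nat.coprime_one_left _) (LinearEquiv.refl F K) fun t ht => ?_
  obtain rfl : t = 0 := by omega
  exact Submodule.subset_span (Or.inl rfl)

theorem hasIndexes_dual_C₁ (hn : finrank F K = 6) {δ : K} (hδ : δ ≠ 0) :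
    HasIndexes (dual (C₁ F δ)) 4 2 2 := by
  have hk : finrank K (dual (C₁ F δ)) = 4 := by
    have h1 := le_finrank_dual (C₁ F δ)
    rw [finrank_C₁ hn, hn] at h1
    refine le_antisymm ?_ (by omega)
    refine finrank_le_of_coeffAt hn {1, 2, 3, 5} rfl fun f hf h t ht => ?_
    have := mem_dual_C₁.1 hf
    interval_cases t <;> simp_all
  refine ⟨hk, le_antisymm ?_ ?_, ?_⟩
  -- The members of the chain kill positions `0, -s, -2s`, one in each class modulo `3`. Their
  -- second conditions tie together the two positions of each class, so with `δ ≠ 0` everything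
  -- vanishes. For `δ = 0` the chain `x^[1], x^[2], x^[3]` would lie in the code.
  · refine gabidulinIndex_le_of_coeffAt hn (by omega) fun s hs hsc f hf t ht => ?_
    have h0 := mem_dual_C₁.1 (hf 0 (by omega))
    have h1 := mem_dual_C₁.1 (hf 1 (by omega))
    have h2 := mem_dual_C₁.1 (hf 2 (by omega))
    clear hf
    interval_cases s <;> first | exact absurd hsc (by decide) | skip
    all_goals
      simp [coeffAt_mono_comp_of_le hn] at h0 h1 h2
      interval_cases t <;> simp_all
  · refine le_gabidulinIndex (s := 1) (by omega) (by omega) (Nat.coprime_one_left _)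
      (monoEquiv F K 2) fun t ht => ?_
    rw [coe_monoEquiv, mono_comp_mono, mem_dual_C₁]
    interval_cases t <;> simp [coeffAt_mono_of_finrank hn]
  · refine hIndex_eq_of_finrank hn (by omega) (by omega) fun j h0 hj hjc => ?_
    interval_cases j <;> first | exact absurd hjc (by decide) | skip
    · refine finrank_inf_conj_le hn hj.le {2, 3} rfl fun f hf hf' _ t ht => ?_
      have h1 := mem_dual_C₁.1 hf
      have h2 := mem_dual_C₁.1 hf'
      simp [coeffAt_mono_comp_of_le hn] at h2
      interval_cases t <;> simp_all
    · refine finrank_inf_conj_le hn hj.le {1, 2} rfl fun f hf hf' _ t ht => ?_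
      have h1 := mem_dual_C₁.1 hf
      have h2 := mem_dual_C₁.1 hf'
      simp [coeffAt_mono_comp_of_le hn] at h2
      interval_cases t <;> simp_all

theorem finrank_D₁ (hn : finrank F K = 6) (δ : K) : finrank K (D₁ F δ) = 4 := by
  apply le_antisymm
  · refine finrank_le_of_coeffAt hn {0, 1, 2, 4} rfl fun f hf h t ht => ?_
    have := coeffAt_of_mem_D₁ hn hf
    interval_cases t <;> simp_all
  · have := card_le_finrank_of_dual (D₁ F δ) ![mono F K 1, mono F K 2, mono F K 4,
      mono F K 0 - (δ ^ (Fintype.card F ^ 5)) • mono F K 3] ![1, 2, 4, 0]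
      (by intro i; fin_cases i <;> exact Submodule.subset_span (by simp))
      (by intro i j; fin_cases i <;> fin_cases j <;> simp [coeffAt_mono_of_finrank hn])
    simpa using this

theorem hasIndexes_D₁ (hn : finrank F K = 6) {δ : K} (hδ : δ ≠ 0) :
    HasIndexes (D₁ F δ) 4 2 2 := by
  have hk := finrank_D₁ hn δ
  have hδ' : δ ^ (Fintype.card F ^ 5) ≠ 0 := pow_ne_zero _ hδ
  refine ⟨hk, le_antisymm ?_ ?_, ?_⟩
  · refine gabidulinIndex_le_of_coeffAt hn (by omega) fun s hs hsc f hf t ht => ?_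
    have h0 := coeffAt_of_mem_D₁ hn (hf 0 (by omega))
    have h1 := coeffAt_of_mem_D₁ hn (hf 1 (by omega))
    have h2 := coeffAt_of_mem_D₁ hn (hf 2 (by omega))
    clear hf
    interval_cases s <;> first | exact absurd hsc (by decide) | skip
    all_goals
      simp [coeffAt_mono_comp_of_le hn] at h0 h1 h2
      interval_cases t <;> simp_all
  · refine le_gabidulinIndex (s := 1) (by omega) (by omega) (Nat.coprime_one_left _)
      (monoEquiv F K 1) fun t ht => ?_
    rw [coe_monoEquiv, mono_comp_mono]
    interval_cases t <;> exact Submodule.subset_span (by simp)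
  · refine hIndex_eq_of_finrank hn (by omega) (by omega) fun j h0 hj hjc => ?_
    interval_cases j <;> first | exact absurd hjc (by decide) | skip
    · refine finrank_inf_conj_le hn hj.le {1, 2} rfl fun f hf hf' _ t ht => ?_
      have h1 := coeffAt_of_mem_D₁ hn hf
      have h2 := coeffAt_of_mem_D₁ hn hf'
      simp [coeffAt_mono_comp_of_le hn] at h2
      interval_cases t <;> simp_all
    · refine finrank_inf_conj_le hn hj.le {0, 1} rfl fun f hf hf' _ t ht => ?_
      have h1 := coeffAt_of_mem_D₁ hn hf
      have h2 := coeffAt_of_mem_D₁ hn hf'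
      simp [coeffAt_mono_comp_of_le hn] at h2
      interval_cases t <;> simp_all

/-- If `δ = 0` then `C₁` contains `x - x^[4]`, whose kernel is too large. -/
theorem ne_zero_of_isMRD_C₁ (hn : finrank F K = 6) {δ : K} (h : IsMRD (C₁ F δ)) : δ ≠ 0 := by
  rintro rfl
  -- Dimension `2` and `n = 6` turn the MRD equation into `6 + 1 - d = 2`.
  have hdist : minDist (C₁ F (0 : K) : Set (K →ₗ[F] K)) = 5 := by
    rw [IsMRD, natCard_eq_pow_finrank (K := K) (V := C₁ F (0 : K)), finrank_C₁ hn,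
      natCard_eq_pow_finrank (K := F) (V := K), hn, Nat.card_eq_fintype_card, ← pow_mul] at h
    have := Nat.pow_right_injective Fintype.one_lt_card h
    omega
  -- The left side is the trace of `z` to the fixed field of `x^[2]`. Independence of the monomials
  -- gives a value `y` not fixed by `x^[1]`, so `1` and `y` are independent in the kernel of `x -
  -- x^[4]`, whose rank is then at most `4`.
  obtain ⟨z, hz⟩ : ∃ z : K, mono F K 0 z + mono F K 2 z + mono F K 4 z ≠
      mono F K 1 z + mono F K 3 z + mono F K 5 z := by
    by_contra hcon
    push Not at hcon
    have h1 : mono F K 0 + mono F K 2 + mono F K 4 = mono F K 1 + mono F K 3 + mono F K 5 :=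
      LinearMap.ext hcon
    have h2 := congrArg (coeffAt 0) h1
    simp [coeffAt_mono_of_finrank hn] at h2
  set y := mono F K 0 z + mono F K 2 z + mono F K 4 z with hy
  have hf (i j : ℕ) (x : K) : frob F K i (mono F K j x) = mono F K (i + j) x :=
    (frob_add_apply i j x).symm
  have h6 : mono F K 6 = mono F K 0 := mono_congr (by rw [hn]; rfl)
  have h8 : mono F K 8 = mono F K 2 := mono_congr (by rw [hn]; rfl)
  have hy4 : frob F K 4 y = y := by
    rw [hy, map_add, map_add, hf, hf, hf]
    norm_num [h6, h8]
    ring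
  have hy1 : frob F K 1 y ≠ y := by
    rw [hy, map_add, map_add, hf, hf, hf]
    exact hz.symm
  let φ : K →ₗ[F] K := mono F K 0 - mono F K 4
  have hφ : ∀ x, frob F K 4 x = x → x ∈ LinearMap.ker φ := fun x hx => by
    rw [LinearMap.mem_ker]
    change x - frob F K 4 x = 0
    rw [hx, sub_self]
  have hli : LinearIndependent F ![(⟨1, hφ 1 (map_one _)⟩ : LinearMap.ker φ), ⟨y, hφ y hy4⟩] := by
    rw [LinearIndependent.pair_iff' (by simp)]
    intro a ha
    have ha' : a • (1 : K) = y := congrArg Subtype.val ha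
    apply hy1
    rw [← ha', map_smul, map_one]
  have h2 := hli.fintype_card_le_finrank
  have h3 := LinearMap.finrank_range_add_finrank_ker φ
  rw [Fintype.card_fin] at h2
  have h4 : minDist (C₁ F (0 : K) : Set (K →ₗ[F] K)) ≤ finrank F (LinearMap.range φ) := by
    refine Nat.sInf_le ⟨mono F K 0, Submodule.subset_span (by simp), mono F K 4,
      Submodule.subset_span (by simp), ?_, rfl⟩
    intro h5
    have := congrArg (coeffAt 0) h5
    simp [coeffAt_mono_of_finrank hn] at this
  omega

end First

end Sporadic

/-! ### The codes `C₂`, its dual and `D₂` -/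

section Second

variable {F K : Type*} [Field F] [Fintype F] [Field K] [Finite K] [Algebra F K]

theorem coeffAt_of_mem_C₂ (hn : finrank F K = 6) {δ : K} {f : K →ₗ[F] K} (hf : f ∈ C₂ F δ) :
    coeffAt 2 f = 0 ∧ coeffAt 4 f = 0 ∧ coeffAt 3 f = coeffAt 1 f ∧
      coeffAt 5 f = δ * coeffAt 1 f := by
  induction hf using Submodule.span_induction with
  | mem x hx =>
    rcases hx with rfl | rfl <;> simp [coeffAt_mono_of_finrank hn]
  | zero => simp
  | add x y _ _ hx hy => simp [hx, hy, mul_add]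
  | smul a x _ hx => simp [hx, mul_left_comm]

theorem mem_dual_C₂ {δ : K} {f : K →ₗ[F] K} :
    f ∈ dual (C₂ F δ) ↔
      coeffAt 0 f = 0 ∧ coeffAt 1 f + coeffAt 3 f + δ * coeffAt 5 f = 0 := by
  simp [C₂, mem_dual_span, pairing_mono]

theorem coeffAt_of_mem_D₂ (hn : finrank F K = 6) {δ : K} {f : K →ₗ[F] K} (hf : f ∈ D₂ F δ) :
    coeffAt 5 f = 0 ∧ coeffAt 0 f + coeffAt 2 f + δ * coeffAt 4 f = 0 := by
  induction hf using Submodule.span_induction with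
  | mem x hx =>
    rcases hx with rfl | rfl | rfl | rfl <;> simp [coeffAt_mono_of_finrank hn]
  | zero => simp
  | add x y _ _ hx hy =>
    refine ⟨by simp [hx, hy], ?_⟩
    simp only [map_add]
    linear_combination hx.2 + hy.2
  | smul a x _ hx =>
    refine ⟨by simp [hx], ?_⟩
    simp only [map_smul, smul_eq_mul]
    linear_combination a * hx.2

-- As `δ` lies in `F`, the relation is stable under Frobenius, so conditions on `g^[a]` become
-- conditions on `g` with the same `δ`.
omit [Finite K] in
theorem frob_relation (a : ℕ) (δ : F) (x y z : K) :
    frob F K a x + frob F K a y + algebraMap F K δ * frob F K a z = 0 ↔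
      x + y + algebraMap F K δ * z = 0 := by
  have h : frob F K a x + frob F K a y + algebraMap F K δ * frob F K a z =
      frob F K a (x + y + algebraMap F K δ * z) := by simp
  rw [h, map_eq_zero]

theorem coeffAt_of_mono_comp_mem_dual_C₂ (hn : finrank F K = 6) {δ : F} {f : K →ₗ[F] K} {a : ℕ}
    (ha : a ≤ 6) (hf : mono F K a ∘ₗ f ∈ dual (C₂ F (algebraMap F K δ))) :
    coeffAt ((0 + (6 - a)) % 6) f = 0 ∧ coeffAt ((1 + (6 - a)) % 6) f +
      coeffAt ((3 + (6 - a)) % 6) f + algebraMap F K δ * coeffAt ((5 + (6 - a)) % 6) f = 0 := by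
  rwa [mem_dual_C₂, coeffAt_mono_comp_of_le hn ha, coeffAt_mono_comp_of_le hn ha,
    coeffAt_mono_comp_of_le hn ha, coeffAt_mono_comp_of_le hn ha, map_eq_zero, frob_relation] at hf

theorem coeffAt_of_mono_comp_mem_D₂ (hn : finrank F K = 6) {δ : F} {f : K →ₗ[F] K} {a : ℕ}
    (ha : a ≤ 6) (hf : mono F K a ∘ₗ f ∈ D₂ F (algebraMap F K δ)) :
    coeffAt ((5 + (6 - a)) % 6) f = 0 ∧ coeffAt ((0 + (6 - a)) % 6) f +
      coeffAt ((2 + (6 - a)) % 6) f + algebraMap F K δ * coeffAt ((4 + (6 - a)) % 6) f = 0 := by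
  have h := coeffAt_of_mem_D₂ hn hf
  rwa [coeffAt_mono_comp_of_le hn ha, coeffAt_mono_comp_of_le hn ha,
    coeffAt_mono_comp_of_le hn ha, coeffAt_mono_comp_of_le hn ha, map_eq_zero, frob_relation] at h

theorem finrank_C₂ (hn : finrank F K = 6) (δ : K) : finrank K (C₂ F δ) = 2 := by
  apply le_antisymm
  · refine finrank_le_of_coeffAt hn {0, 1} rfl fun f hf h t ht => ?_
    have := coeffAt_of_mem_C₂ hn hf
    interval_cases t <;> simp_all
  · have := card_le_finrank_of_dual (C₂ F δ)
      ![mono F K 0, mono F K 1 + mono F K 3 + δ • mono F K 5] ![0, 1]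
      (by intro i; fin_cases i <;> exact Submodule.subset_span (by simp))
      (by intro i j; fin_cases i <;> fin_cases j <;> simp [coeffAt_mono_of_finrank hn])
    simpa using this

theorem hasIndexes_C₂ (hn : finrank F K = 6) (δ : K) : HasIndexes (C₂ F δ) 2 1 0 := by
  have h0 : hIndex (C₂ F δ) = 0 := by
    refine hIndex_eq_of_finrank hn (by omega) (Or.inl rfl) fun j h0 hj hjc => ?_
    refine finrank_inf_conj_le hn hj.le ∅ rfl fun f hf hf' _ t ht => ?_
    have h1 := coeffAt_of_mem_C₂ hn hf
    have h2 := coeffAt_of_mem_C₂ hn hf'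
    clear hf hf'
    interval_cases j <;> first | exact absurd hjc (by decide) | skip
    all_goals
      simp [coeffAt_mono_comp_of_le hn] at h2
      interval_cases t <;> simp_all [@eq_comm K 0]
  refine hasIndexes_of_mono_comp_mem (s := 1) (by omega) (finrank_C₂ hn δ) (by omega) h0
    (Nat.coprime_one_left _) (LinearEquiv.refl F K) fun t ht => ?_
  obtain rfl : t = 0 := by omega
  exact Submodule.subset_span (Or.inl rfl)

omit [Fintype F] [Finite K] in
theorem ne_one_of_sq_add_self {δ : F} (hδ : δ ^ 2 + δ = 1) : algebraMap F K δ ≠ 1 := by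
  intro h
  have : δ = 1 := (algebraMap F K).injective (by rw [h, map_one])
  rw [this] at hδ
  exact one_ne_zero (α := F) (by linear_combination hδ)

theorem two_ne_zero_of_odd_card (hF : Odd (Fintype.card F)) : (2 : F) ≠ 0 := by
  intro h
  have h2 : ringChar F = 2 := CharP.ringChar_of_prime_eq_zero Nat.prime_two (by exact_mod_cast h)
  have := FiniteField.even_card_of_char_two h2
  rw [Nat.odd_iff] at hF
  omega

/-- The map `x^[2] - δ x` is invertible since its kernel would force `δ ^ 3 = 1`. -/
theorem exists_equiv_mono_two_sub (hn : finrank F K = 6) (hF : Odd (Fintype.card F)) {δ : F}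
    (hδ : δ ^ 2 + δ = 1) :
    ∃ e : K ≃ₗ[F] K, ∀ t a, mono F K t ∘ₗ ((monoEquiv F K a).trans e : K ≃ₗ[F] K).toLinearMap =
      mono F K (t + a + 2) - algebraMap F K δ • mono F K (t + a) := by
  let φ : K →ₗ[F] K := mono F K 2 - algebraMap F K δ • mono F K 0
  have hφ : ∀ x, φ x = frob F K 2 x - algebraMap F K δ * x := fun x => rfl
  have hinj : Function.Injective φ := by
    rw [injective_iff_map_eq_zero]
    intro x hx
    rw [hφ, sub_eq_zero] at hx
    have h6 : frob F K 6 x = x := by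
      rw [frob_congr (j := 0) (by rw [hn]; rfl)]
      rfl
    rw [show 6 = 2 + (2 + 2) from rfl, frob_add_apply, frob_add_apply] at h6
    simp only [hx, map_mul, AlgHom.commutes] at h6
    have h1 : algebraMap F K (δ ^ 2 + δ) = 1 := by rw [hδ, map_one]
    rw [map_add, map_pow] at h1
    set d := algebraMap F K δ
    -- On the kernel `x = x^[6] = δ³x`, and `δ² = 1 - δ` gives `δ³ - 1 = 2(δ - 1)`.
    have h2 : algebraMap F K 2 * ((d - 1) * x) = 0 := by
      rw [map_ofNat]
      linear_combination h6 + (1 - d) * x * h1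
    rw [mul_eq_zero, map_eq_zero, mul_eq_zero, sub_eq_zero] at h2
    exact (h2.resolve_left (two_ne_zero_of_odd_card hF)).resolve_left (ne_one_of_sq_add_self hδ)
  refine ⟨LinearEquiv.ofBijective φ ⟨hinj, Finite.surjective_of_injective hinj⟩, fun t a => ?_⟩
  ext x
  change frob F K t (φ (frob F K a x)) = frob F K (t + a + 2) x - _ * frob F K (t + a) x
  rw [hφ, map_sub, map_mul, AlgHom.commutes, ← frob_add_apply, ← frob_add_apply, ← frob_add_apply]
  congr 3
  omega

theorem hasIndexes_dual_C₂ (hn : finrank F K = 6) (hF : Odd (Fintype.card F)) {δ : F}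
    (hδ : δ ^ 2 + δ = 1) : HasIndexes (dual (C₂ F (algebraMap F K δ))) 4 2 2 := by
  have hk : finrank K (dual (C₂ F (algebraMap F K δ))) = 4 := by
    have h1 := le_finrank_dual (C₂ F (algebraMap F K δ))
    rw [finrank_C₂ hn, hn] at h1
    refine le_antisymm ?_ (by omega)
    refine finrank_le_of_coeffAt hn {2, 3, 4, 5} rfl fun f hf h t ht => ?_
    have := mem_dual_C₂.1 hf
    interval_cases t <;> simp_all
  have hδ1 := sub_ne_zero.2 (ne_one_of_sq_add_self (K := K) hδ)
  refine ⟨hk, le_antisymm ?_ ?_, ?_⟩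
  · refine gabidulinIndex_le_of_coeffAt hn (by omega) fun s hs hsc f hf t ht => ?_
    have h0 := coeffAt_of_mono_comp_mem_dual_C₂ hn (Nat.mod_lt _ (by omega)).le (hf 0 (by omega))
    have h1 := coeffAt_of_mono_comp_mem_dual_C₂ hn (Nat.mod_lt _ (by omega)).le (hf 1 (by omega))
    have h2 := coeffAt_of_mono_comp_mem_dual_C₂ hn (Nat.mod_lt _ (by omega)).le (hf 2 (by omega))
    clear hf
    interval_cases s <;> first | exact absurd hsc (by decide) | skip
    · norm_num at h0 h1 h2
      -- The relations for `g` and `g^[2]` involve the same positions `1, 3, 5`, cyclically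
      -- permuted; position `5` is zero, so their difference is `δ - 1` times the coefficient at
      -- `3`.
      have h3 : coeffAt 3 f = 0 := by
        refine (mul_eq_zero.1 ?_).resolve_left hδ1
        linear_combination h2.2 - h0.2 + (algebraMap F K δ - 1) * h1.1
      interval_cases t <;> simp_all
    · norm_num at h0 h1 h2
      have h3 : coeffAt 5 f = 0 := by
        refine (mul_eq_zero.1 ?_).resolve_left hδ1
        linear_combination h0.2 - h2.2 + (algebraMap F K δ - 1) * h1.1
      interval_cases t <;> simp_all
  -- The only monomials in the code are `x^[2]` and `x^[4]`, so a binomial is needed: the chain is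
  -- `x^[4] - δx^[2]`, `x^[5] - δx^[3]`.
  · obtain ⟨e, he⟩ := exists_equiv_mono_two_sub hn hF hδ
    refine le_gabidulinIndex (s := 1) (by omega) (by omega) (Nat.coprime_one_left _)
      ((monoEquiv F K 2).trans e) fun t ht => ?_
    rw [he, mem_dual_C₂]
    simp only [map_sub, map_smul, smul_eq_mul]
    interval_cases t <;> simp [coeffAt_mono_of_finrank hn]
  · refine hIndex_eq_of_finrank hn (by omega) (by omega) fun j h0 hj hjc => ?_
    interval_cases j <;> first | exact absurd hjc (by decide) | skip
    · refine finrank_inf_conj_le hn hj.le {4, 5} rfl fun f hf hf' _ t ht => ?_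
      have h1 := mem_dual_C₂.1 hf
      have h2 := coeffAt_of_mono_comp_mem_dual_C₂ hn (by omega) hf'
      norm_num at h2
      interval_cases t <;> simp_all
    · refine finrank_inf_conj_le hn hj.le {3, 4} rfl fun f hf hf' _ t ht => ?_
      have h1 := mem_dual_C₂.1 hf
      have h2 := coeffAt_of_mono_comp_mem_dual_C₂ hn (by omega) hf'
      norm_num at h2
      interval_cases t <;> simp_all

theorem finrank_D₂ (hn : finrank F K = 6) (δ : K) : finrank K (D₂ F δ) = 4 := by
  apply le_antisymm
  · refine finrank_le_of_coeffAt hn {1, 2, 3, 4} rfl fun f hf h t ht => ?_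
    have := coeffAt_of_mem_D₂ hn hf
    interval_cases t <;> simp_all
  -- Position `2` detects `x - x^[2]`, since `x` also occurs in `x^[4] - δx`; hence the sign.
  · have := card_le_finrank_of_dual (D₂ F δ) ![mono F K 1, mono F K 3,
      -(mono F K 0 - mono F K 2), mono F K 4 - δ • mono F K 0] ![1, 3, 2, 4]
      (by
        intro i
        fin_cases i
        · exact Submodule.subset_span (by simp)
        · exact Submodule.subset_span (by simp)
        · exact Submodule.neg_mem _ (Submodule.subset_span (by simp))
        · exact Submodule.subset_span (by simp))
      (by intro i j; fin_cases i <;> fin_cases j <;> simp [coeffAt_mono_of_finrank hn])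
    simpa using this

theorem hasIndexes_D₂ (hn : finrank F K = 6) (hF : Odd (Fintype.card F)) {δ : F}
    (hδ : δ ^ 2 + δ = 1) : HasIndexes (D₂ F (algebraMap F K δ)) 4 2 2 := by
  have hk := finrank_D₂ hn (algebraMap F K δ)
  have hδ1 := sub_ne_zero.2 (ne_one_of_sq_add_self (K := K) hδ)
  refine ⟨hk, le_antisymm ?_ ?_, ?_⟩
  · refine gabidulinIndex_le_of_coeffAt hn (by omega) fun s hs hsc f hf t ht => ?_
    have h0 := coeffAt_of_mono_comp_mem_D₂ hn (Nat.mod_lt _ (by omega)).le (hf 0 (by omega))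
    have h1 := coeffAt_of_mono_comp_mem_D₂ hn (Nat.mod_lt _ (by omega)).le (hf 1 (by omega))
    have h2 := coeffAt_of_mono_comp_mem_D₂ hn (Nat.mod_lt _ (by omega)).le (hf 2 (by omega))
    clear hf
    interval_cases s <;> first | exact absurd hsc (by decide) | skip
    · norm_num at h0 h1 h2
      have h3 : coeffAt 2 f = 0 := by
        refine (mul_eq_zero.1 ?_).resolve_left hδ1
        linear_combination h2.2 - h0.2 + (algebraMap F K δ - 1) * h1.1
      interval_cases t <;> simp_all
    · norm_num at h0 h1 h2
      have h3 : coeffAt 4 f = 0 := by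
        refine (mul_eq_zero.1 ?_).resolve_left hδ1
        linear_combination h0.2 - h2.2 + (algebraMap F K δ - 1) * h1.1
      interval_cases t <;> simp_all
  -- The chain is `x^[3] - δx^[1]`, `x^[4] - δx^[2]`, the latter being `(x^[4] - δx) + δ(x -
  -- x^[2])`.
  · obtain ⟨e, he⟩ := exists_equiv_mono_two_sub hn hF hδ
    refine le_gabidulinIndex (s := 1) (by omega) (by omega) (Nat.coprime_one_left _)
      ((monoEquiv F K 1).trans e) fun t ht => ?_
    rw [he]
    have h1 : mono F K 1 ∈ D₂ F (algebraMap F K δ) := Submodule.subset_span (by simp)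
    have h3 : mono F K 3 ∈ D₂ F (algebraMap F K δ) := Submodule.subset_span (by simp)
    have h02 : mono F K 0 - mono F K 2 ∈ D₂ F (algebraMap F K δ) :=
      Submodule.subset_span (by simp)
    have h40 : mono F K 4 - algebraMap F K δ • mono F K 0 ∈ D₂ F (algebraMap F K δ) :=
      Submodule.subset_span (by simp)
    interval_cases t
    · exact Submodule.sub_mem _ h3 (Submodule.smul_mem _ _ h1)
    · have := Submodule.add_mem _ h40 (Submodule.smul_mem _ (algebraMap F K δ) h02)
      rwa [smul_sub, sub_add_sub_cancel] at this
  · refine hIndex_eq_of_finrank hn (by omega) (by omega) fun j h0 hj hjc => ?_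
    interval_cases j <;> first | exact absurd hjc (by decide) | skip
    · refine finrank_inf_conj_le hn hj.le {3, 4} rfl fun f hf hf' _ t ht => ?_
      have h1 := coeffAt_of_mem_D₂ hn hf
      have h2 := coeffAt_of_mono_comp_mem_D₂ hn (by omega) hf'
      norm_num at h2
      interval_cases t <;> simp_all
    · refine finrank_inf_conj_le hn hj.le {2, 3} rfl fun f hf hf' _ t ht => ?_
      have h1 := coeffAt_of_mem_D₂ hn hf
      have h2 := coeffAt_of_mono_comp_mem_D₂ hn (by omega) hf'
      norm_num at h2
      interval_cases t <;> simp_all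

end Second

/-! ### The codes `C₄`, its dual and `D₄` -/

section Fourth

variable {F K : Type*} [Field F] [Fintype F] [Field K] [Finite K] [Algebra F K]

theorem coeffAt_of_mem_C₄ (hn : finrank F K = 8) {δ : K} {f : K →ₗ[F] K} (hf : f ∈ C₄ F δ) :
    coeffAt 2 f = 0 ∧ coeffAt 3 f = 0 ∧ coeffAt 4 f = 0 ∧ coeffAt 6 f = 0 ∧ coeffAt 7 f = 0 ∧
      coeffAt 1 f = δ * coeffAt 5 f := by
  induction hf using Submodule.span_induction with
  | mem x hx =>
    rcases hx with rfl | rfl <;> simp [coeffAt_mono_of_finrank hn]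
  | zero => simp
  | add x y _ _ hx hy => simp [hx, hy, mul_add]
  | smul a x _ hx => simp [hx, mul_left_comm]

theorem mem_dual_C₄ {δ : K} {f : K →ₗ[F] K} :
    f ∈ dual (C₄ F δ) ↔ coeffAt 0 f = 0 ∧ δ * coeffAt 1 f + coeffAt 5 f = 0 := by
  simp [C₄, mem_dual_span, pairing_mono]

theorem coeffAt_of_mem_D₄ (hn : finrank F K = 8) {δ : K} {f : K →ₗ[F] K} (hf : f ∈ D₄ F δ) :
    coeffAt 7 f = 0 ∧ coeffAt 4 f = -(δ * coeffAt 0 f) := by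
  induction hf using Submodule.span_induction with
  | mem x hx =>
    rcases hx with rfl | rfl | rfl | rfl | rfl | rfl <;> simp [coeffAt_mono_of_finrank hn]
  | zero => simp
  | add x y _ _ hx hy => simp [hx, hy, mul_add]; ring
  | smul a x _ hx => simp [hx, mul_left_comm]

theorem finrank_C₄ (hn : finrank F K = 8) (δ : K) : finrank K (C₄ F δ) = 2 := by
  apply le_antisymm
  · refine finrank_le_of_coeffAt hn {0, 5} rfl fun f hf h t ht => ?_
    have := coeffAt_of_mem_C₄ hn hf
    interval_cases t <;> simp_all
  · have := card_le_finrank_of_dual (C₄ F δ) ![mono F K 0, δ • mono F K 1 + mono F K 5] ![0, 5]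
      (by intro i; fin_cases i <;> exact Submodule.subset_span (by simp))
      (by intro i j; fin_cases i <;> fin_cases j <;> simp [coeffAt_mono_of_finrank hn])
    simpa using this

/-- For `δ = 0` the monomial `x^[5]` would lie in both the code and its conjugate by `5`, so `h`
would not be `0`. -/
theorem hasIndexes_C₄ (hn : finrank F K = 8) {δ : K} (hδ : δ ≠ 0) :
    HasIndexes (C₄ F δ) 2 1 0 := by
  have h0 : hIndex (C₄ F δ) = 0 := by
    refine hIndex_eq_of_finrank hn (by omega) (Or.inl rfl) fun j h0 hj hjc => ?_
    refine finrank_inf_conj_le hn hj.le ∅ rfl fun f hf hf' _ t ht => ?_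
    have h1 := coeffAt_of_mem_C₄ hn hf
    have h2 := coeffAt_of_mem_C₄ hn hf'
    clear hf hf'
    interval_cases j <;> first | exact absurd hjc (by decide) | skip
    all_goals
      simp [coeffAt_mono_comp_of_le hn] at h2
      interval_cases t <;> simp_all [@eq_comm K 0]
  refine hasIndexes_of_mono_comp_mem (s := 1) (by omega) (finrank_C₄ hn δ) (by omega) h0
    (Nat.coprime_one_left _) (LinearEquiv.refl F K) fun t ht => ?_
  obtain rfl : t = 0 := by omega
  exact Submodule.subset_span (Or.inl rfl)

theorem forall_lt_eight {p : ℕ → Prop} :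
    (∀ t < 8, p t) ↔ p 0 ∧ p 1 ∧ p 2 ∧ p 3 ∧ p 4 ∧ p 5 ∧ p 6 ∧ p 7 := by
  refine ⟨fun h => by simp [h], fun h t ht => ?_⟩
  interval_cases t <;> tauto

theorem hIndex_dual_C₄ (hn : finrank F K = 8) {δ : K} (hδ : δ ≠ 0)
    (hk : finrank K (dual (C₄ F δ)) = 6) : hIndex (dual (C₄ F δ)) = 4 := by
  have key : ∀ j < 8, ∀ T : Finset ℕ, T.card = 4 →
      (∀ f : K →ₗ[F] K, (coeffAt 0 f = 0 ∧ δ * coeffAt 1 f + coeffAt 5 f = 0) →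
        (coeffAt ((0 + j) % 8) f = 0 ∧ δ * frob F K (8 - j) (coeffAt ((1 + j) % 8) f) +
          frob F K (8 - j) (coeffAt ((5 + j) % 8) f) = 0) →
        (∀ t ∈ T, coeffAt t f = 0) → ∀ t < 8, coeffAt t f = 0) →
      finrank K (dual (C₄ F δ) ⊓ conj (dual (C₄ F δ)) j : Submodule K (K →ₗ[F] K)) ≤ 4 := by
    intro j hj T hT h
    refine finrank_inf_conj_le hn hj.le T hT fun f hf hf' => h f (mem_dual_C₄.1 hf) ?_
    have h2 := mem_dual_C₄.1 hf'
    rwa [coeffAt_mono_comp_of_le hn (Nat.sub_le 8 j), coeffAt_mono_comp_of_le hn (Nat.sub_le 8 j),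
      coeffAt_mono_comp_of_le hn (Nat.sub_le 8 j), map_eq_zero, Nat.sub_sub_self hj.le] at h2
  refine hIndex_eq_of_finrank hn (by omega) (by omega) fun j h0 hj hjc => ?_
  interval_cases j <;> first | exact absurd hjc (by decide) | skip
  · refine key 1 hj {2, 3, 4, 7} rfl fun f h1 h2 hT => ?_
    clear key hk hn hj hjc
    simp at h2 hT
    simp_all [forall_lt_eight]
  · refine key 3 hj {1, 2, 6, 7} rfl fun f h1 h2 hT => ?_
    clear key hk hn hj hjc
    simp at h2 hT
    simp_all [forall_lt_eight]
  · refine key 5 hj {3, 4, 6, 7} rfl fun f h1 h2 hT => ?_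
    clear key hk hn hj hjc
    simp at h2 hT
    simp_all [forall_lt_eight]
  · refine key 7 hj {1, 2, 3, 6} rfl fun f h1 h2 hT => ?_
    clear key hk hn hj hjc
    simp at h2 hT
    simp_all [forall_lt_eight]

theorem hasIndexes_dual_C₄ (hn : finrank F K = 8) {δ : K} (hδ : δ ≠ 0) :
    HasIndexes (dual (C₄ F δ)) 6 3 4 := by
  have hk : finrank K (dual (C₄ F δ)) = 6 := by
    have h1 := le_finrank_dual (C₄ F δ)
    rw [finrank_C₄ hn, hn] at h1
    refine le_antisymm ?_ (by omega)
    refine finrank_le_of_coeffAt hn {1, 2, 3, 4, 6, 7} rfl fun f hf h t ht => ?_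
    have := mem_dual_C₄.1 hf
    interval_cases t <;> simp_all
  refine ⟨hk, le_antisymm ?_ ?_, hIndex_dual_C₄ hn hδ hk⟩
  -- As `s` is odd, the killed positions `0, -s, -2s, -3s` meet each class modulo `4` once, and the
  -- second conditions tie the two positions of each class. The same mechanism works for `D₄`,
  -- starting from position `7`.
  · refine gabidulinIndex_le_of_coeffAt hn (by omega) fun s hs hsc f hf t ht => ?_
    have h0 := mem_dual_C₄.1 (hf 0 (by omega))
    have h1 := mem_dual_C₄.1 (hf 1 (by omega))
    have h2 := mem_dual_C₄.1 (hf 2 (by omega))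
    have h3 := mem_dual_C₄.1 (hf 3 (by omega))
    clear hf
    interval_cases s <;> first | exact absurd hsc (by decide) | skip
    all_goals
      simp [coeffAt_mono_comp_of_le hn] at h0 h1 h2 h3
      interval_cases t <;> simp_all
  · refine le_gabidulinIndex (s := 1) (by omega) (by omega) (Nat.coprime_one_left _)
      (monoEquiv F K 2) fun t ht => ?_
    rw [coe_monoEquiv, mono_comp_mono, mem_dual_C₄]
    interval_cases t <;> simp [coeffAt_mono_of_finrank hn]

theorem finrank_D₄ (hn : finrank F K = 8) (δ : K) : finrank K (D₄ F δ) = 6 := by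
  apply le_antisymm
  · refine finrank_le_of_coeffAt hn {0, 1, 2, 3, 5, 6} rfl fun f hf h t ht => ?_
    have := coeffAt_of_mem_D₄ hn hf
    interval_cases t <;> simp_all
  · have := card_le_finrank_of_dual (D₄ F δ) ![mono F K 1, mono F K 2, mono F K 3, mono F K 5,
      mono F K 6, mono F K 0 - δ • mono F K 4] ![1, 2, 3, 5, 6, 0]
      (by intro i; fin_cases i <;> exact Submodule.subset_span (by simp))
      (by intro i j; fin_cases i <;> fin_cases j <;> simp [coeffAt_mono_of_finrank hn])
    simpa using this

theorem hIndex_D₄ (hn : finrank F K = 8) {δ : K} (hδ : δ ≠ 0) : hIndex (D₄ F δ) = 4 := by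
  have key : ∀ j < 8, ∀ T : Finset ℕ, T.card = 4 →
      (∀ f : K →ₗ[F] K, (coeffAt 7 f = 0 ∧ coeffAt 4 f = -(δ * coeffAt 0 f)) →
        (coeffAt ((7 + j) % 8) f = 0 ∧ frob F K (8 - j) (coeffAt ((4 + j) % 8) f) =
          -(δ * frob F K (8 - j) (coeffAt ((0 + j) % 8) f))) →
        (∀ t ∈ T, coeffAt t f = 0) → ∀ t < 8, coeffAt t f = 0) →
      finrank K (D₄ F δ ⊓ conj (D₄ F δ) j : Submodule K (K →ₗ[F] K)) ≤ 4 := by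
    intro j hj T hT h
    refine finrank_inf_conj_le hn hj.le T hT fun f hf hf' => h f (coeffAt_of_mem_D₄ hn hf) ?_
    have h2 := coeffAt_of_mem_D₄ hn hf'
    rwa [coeffAt_mono_comp_of_le hn (Nat.sub_le 8 j), coeffAt_mono_comp_of_le hn (Nat.sub_le 8 j),
      coeffAt_mono_comp_of_le hn (Nat.sub_le 8 j), map_eq_zero, Nat.sub_sub_self hj.le] at h2
  have hk := finrank_D₄ hn δ
  refine hIndex_eq_of_finrank hn (by omega) (by omega) fun j h0 hj hjc => ?_
  interval_cases j <;> first | exact absurd hjc (by decide) | skip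
  · refine key 1 hj {1, 2, 3, 6} rfl fun f h1 h2 hT => ?_
    clear key hk hn hj hjc
    simp at h2 hT
    simp_all [forall_lt_eight]
  · refine key 3 hj {0, 1, 5, 6} rfl fun f h1 h2 hT => ?_
    clear key hk hn hj hjc
    simp at h2 hT
    simp_all [forall_lt_eight]
  · refine key 5 hj {2, 3, 5, 6} rfl fun f h1 h2 hT => ?_
    clear key hk hn hj hjc
    simp at h2 hT
    simp_all [forall_lt_eight]
  · refine key 7 hj {0, 1, 2, 5} rfl fun f h1 h2 hT => ?_
    clear key hk hn hj hjc
    simp at h2 hT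
    simp_all [forall_lt_eight]

theorem hasIndexes_D₄ (hn : finrank F K = 8) {δ : K} (hδ : δ ≠ 0) :
    HasIndexes (D₄ F δ) 6 3 4 := by
  have hk := finrank_D₄ hn δ
  refine ⟨hk, le_antisymm ?_ ?_, hIndex_D₄ hn hδ⟩
  · refine gabidulinIndex_le_of_coeffAt hn (by omega) fun s hs hsc f hf t ht => ?_
    have h0 := coeffAt_of_mem_D₄ hn (hf 0 (by omega))
    have h1 := coeffAt_of_mem_D₄ hn (hf 1 (by omega))
    have h2 := coeffAt_of_mem_D₄ hn (hf 2 (by omega))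
    have h3 := coeffAt_of_mem_D₄ hn (hf 3 (by omega))
    clear hf
    interval_cases s <;> first | exact absurd hsc (by decide) | skip
    all_goals
      simp [coeffAt_mono_comp_of_le hn] at h0 h1 h2 h3
      interval_cases t <;> simp_all
  · refine le_gabidulinIndex (s := 1) (by omega) (by omega) (Nat.coprime_one_left _)
      (monoEquiv F K 1) fun t ht => ?_
    rw [coe_monoEquiv, mono_comp_mono]
    interval_cases t <;> exact Submodule.subset_span (by simp)

end Fourth

end RankMetric

/-! ### Assembly of the table -/

theorem mainTheorem4 (F K : Type*) [Field F] [Fintype F] [Field K] [Finite K] [Algebra F K] :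
    -- generalized Gabidulin codes
    (∀ (k s : ℕ) (C : Submodule K (K →ₗ[F] K)), 1 ≤ k → k < Module.finrank F K →
      s.Coprime (Module.finrank F K) → RankMetric.Equivalent (RankMetric.gabidulin F K k s) C →
      RankMetric.HasIndexes C k k (k - 1)) ∧
    -- (generalized) twisted Gabidulin codes
    (∀ (k s : ℕ) (η : K) (C : Submodule K (K →ₗ[F] K)), 1 < k → k + 1 < Module.finrank F K →
      s.Coprime (Module.finrank F K) → η ≠ 0 →
      Algebra.norm F η ≠ (-1) ^ (Module.finrank F K * k) →
      RankMetric.Equivalent (RankMetric.twistedGabidulin F k s η) C →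
      RankMetric.HasIndexes C k (k - 1) (k - 2)) ∧
    -- the first sporadic code and its dual
    (Module.finrank F K = 6 → 4 < Fintype.card F → ∀ δ : K,
      RankMetric.IsMRD (RankMetric.C₁ F δ) →
      RankMetric.HasIndexes (RankMetric.C₁ F δ) 2 1 0 ∧
      RankMetric.HasIndexes (RankMetric.dual (RankMetric.C₁ F δ)) 4 2 2 ∧
      RankMetric.HasIndexes (RankMetric.D₁ F δ) 4 2 2) ∧
    -- the second
    (Module.finrank F K = 6 → Odd (Fintype.card F) →
      (Fintype.card F % 5 = 0 ∨ Fintype.card F % 5 = 1 ∨ Fintype.card F % 5 = 4) →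
      ∀ δ : F, δ ^ 2 + δ = 1 →
      RankMetric.HasIndexes (RankMetric.C₂ F (algebraMap F K δ)) 2 1 0 ∧
      RankMetric.HasIndexes (RankMetric.dual (RankMetric.C₂ F (algebraMap F K δ))) 4 2 2 ∧
      RankMetric.HasIndexes (RankMetric.D₂ F (algebraMap F K δ)) 4 2 2) ∧
    -- the third
    (Module.finrank F K = 7 → Odd (Fintype.card F) → ∀ s : ℕ, s.Coprime 7 →
      RankMetric.HasIndexes (RankMetric.C₃₅ F K s) 3 2 1 ∧
      RankMetric.HasIndexes (RankMetric.dual (RankMetric.C₃₅ F K s)) 4 3 2 ∧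
      RankMetric.HasIndexes (RankMetric.D₃ F K s) 4 3 2) ∧
    -- the fourth
    (Module.finrank F K = 8 → Odd (Fintype.card F) → ∀ δ : K, δ ^ 2 = -1 →
      RankMetric.HasIndexes (RankMetric.C₄ F δ) 2 1 0 ∧
      RankMetric.HasIndexes (RankMetric.dual (RankMetric.C₄ F δ)) 6 3 4 ∧
      RankMetric.HasIndexes (RankMetric.D₄ F δ) 6 3 4) ∧
    -- the fifth
    (Module.finrank F K = 8 → Fintype.card F % 3 = 1 → ∀ s : ℕ, s.Coprime 8 →
      RankMetric.HasIndexes (RankMetric.C₃₅ F K s) 3 2 1 ∧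
      RankMetric.HasIndexes (RankMetric.dual (RankMetric.C₃₅ F K s)) 5 4 3 ∧
      RankMetric.HasIndexes (RankMetric.D₅ F K s) 5 4 3) := by
  refine ⟨fun k s C hk0 hk hs hC => ?_, fun k s η C hk1 hk hs hη _ hC => ?_,
    fun hn _ δ hδ => ?_, fun hn hF _ δ hδ => ?_, fun hn _ s hs => RankMetric.hasIndexes_C₃ hn hs,
    fun hn _ δ hδ => ?_, fun hn _ s hs => RankMetric.hasIndexes_C₅ hn hs⟩
  · obtain ⟨i, g, rfl⟩ := hC.exists_of_gabidulin hk0 hk hs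
    exact (RankMetric.hasIndexes_gabidulin hk0 hk hs).conj_map i g
  · have hk0 : 0 < k := by omega
    have hση : ∀ σ : K ≃+* K, σ η ≠ 0 := fun σ => (map_ne_zero_iff σ σ.injective).2 hη
    -- Twisting by `σ` replaces `η` by `σ η`, so the idealizer is needed for every `σ η`.
    obtain ⟨σ, i, g, rfl⟩ := hC.exists_conj_map
      (fun σ => RankMetric.twistedGabidulin F k s (σ η))
      (RankMetric.twist_mem_twistedGabidulin hk0 (by omega) hs)
      fun σ _ => RankMetric.idealizer_twistedGabidulin (hση σ) hk1 hk hs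
    exact (RankMetric.hasIndexes_twistedGabidulin (hση σ) hk1 hk hs).conj_map i g
  · have hδ0 := RankMetric.ne_zero_of_isMRD_C₁ hn hδ
    exact ⟨RankMetric.hasIndexes_C₁ hn δ, RankMetric.hasIndexes_dual_C₁ hn hδ0,
      RankMetric.hasIndexes_D₁ hn hδ0⟩
  · exact ⟨RankMetric.hasIndexes_C₂ hn _, RankMetric.hasIndexes_dual_C₂ hn hF hδ,
      RankMetric.hasIndexes_D₂ hn hF hδ⟩
  · have hδ0 : δ ≠ 0 := by
      rintro rfl
      norm_num at hδ
    exact ⟨RankMetric.hasIndexes_C₄ hn hδ0, RankMetric.hasIndexes_dual_C₄ hn hδ0,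
      RankMetric.hasIndexes_D₄ hn hδ0⟩
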